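/- Let $M$ be a smooth oriented 4-dimensional manifold without boundary and let $f_1,f_2\in C^\infty(M)$ be real-valued. For a Riemannian metric $g$ on $M$ put $$A_4(f_1,f_2)_g=\tfrac13\, r\,\langle df_1,df_2\rangle+\Delta\langle df_1,df_2\rangle+\langle\nabla df_1,\nabla df_2\rangle-\tfrac12\,\Delta f_1\,\Delta f_2 ,$$ where $r$ is the scalar curvature, $\nabla$ the Levi-Civita connection and $\Delta=-\sum_{i,j}g^{ij}\big(\partial_i\partial_j-\sum_k\Gamma^k_{ij}\partial_k\big)$ the Laplacian of $g$, all computed in local coordinates. Let $\bar g,\bar{\bar g}$ be smooth Riemannian metrics on $M$. At each point of a positively oriented coordinate chart let $A_4^j(f_1,f_2)_{(\bar g,\bar{\bar g})}$ and $c_l=(c_l)_{(\bar g,\bar{\bar g})}$ ($0\le j,l\le 2$) be the Taylor coefficients at $\varepsilon=0$ of $\varepsilon\mapsto A_4(f_1,f_2)_{\bar g+\varepsilon\bar{\bar g}}$ and of $\varepsilon\mapsto\sqrt{\det(I+\varepsilon G)}$, where $G=[\bar g]^{-1}[\bar{\bar g}]$ is formed from the matrices of components of the metrics. Then, as $\varepsilon\to0$,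 $$A_4(f_1,f_2)_{\bar g+\varepsilon\bar{\bar g}}=A_4^0+A_4^1\varepsilon+A_4^2\varepsilon^2+O(\varepsilon^3),\qquad \sqrt{\det(I+\varepsilon G)}=1+c_1\varepsilon+c_2\varepsilon^2+O(\varepsilon^3),$$ with $c_0=1$, $$c_1=\tfrac12\sum_{i=1}^4G_{ii},\qquad c_2=\tfrac12\Big(\sum_{1\le i<k\le 4}G_{ii}G_{kk}-\sum_{1\le i<k\le 4}G_{ik}G_{ki}\Big)-\tfrac18\Big(\sum_{i=1}^4G_{ii}\Big)^2,$$ and each of the nine 4-forms $$\Omega^{jl}_{(\bar g,\bar{\bar g})}=A_4^j(f_1,f_2)_{(\bar g,\bar{\bar g})}\;c_l\;d\mathrm{Vol}_{M,\bar g},\qquad 0\le j,l\le2,\qquad d\mathrm{Vol}_{M,\bar g}=\sqrt{\det[\bar g]}\;dx_1\wedge dx_2\wedge dx_3\wedge dx_4,$$ is a bimetric conformal invariant: on every chart of the oriented atlas, $\Omega^{jl}_{(f\bar g,f\bar{\bar g})}=\Omega^{jl}_{(\bar g,\bar{\bar g})}$ for all Riemannian metrics $\bar g,\bar{\bar g}$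 on $M$ and every $f\in C^\infty(M)$ with $f>0$. -/

import Mathlib

open scoped Manifold ContDiff Topology

noncomputable section

namespace Bimetric

/-! ### Tensor calculus in local coordinates -/

/-- The model space of the coordinates `(x₁, …, x₄)`. -/
abbrev E4 : Type := EuclideanSpace ℝ (Fin 4)

/-- The `i`-th partial derivative `∂ᵢ u` of a function of four real variables. -/
def pd (i : Fin 4) (u : E4 → ℝ) (x : E4) : ℝ :=
  fderiv ℝ u x (EuclideanSpace.single i 1)

/-- The Christoffel symbol `Γᵏᵢⱼ = ½ gᵏˡ (∂ⱼ gᵢₗ + ∂ᵢ gⱼₗ - ∂ₗ gᵢⱼ)` of the metric with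
components `G`. -/
def christoffel (G : E4 → Matrix (Fin 4) (Fin 4) ℝ) (k i j : Fin 4) (x : E4) : ℝ :=
  (1 / 2) * ∑ l, (G x)⁻¹ k l *
    (pd j (fun y => G y i l) x + pd i (fun y => G y j l) x - pd l (fun y => G y i j) x)

/-- The scalar curvature
`r = gʲˡ (∂ₖ Γᵏⱼₗ - ∂ⱼ Γᵏₖₗ + Γᵃⱼₗ Γᵏₖₐ - Γᵃₖₗ Γᵏⱼₐ)`. -/
def scalarCurv (G : E4 → Matrix (Fin 4) (Fin 4) ℝ) (x : E4) : ℝ :=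
  ∑ j, ∑ l, (G x)⁻¹ j l * ∑ k,
    (pd k (christoffel G k j l) x - pd j (christoffel G k k l) x
      + ∑ a, (christoffel G a j l x * christoffel G k k a x
        - christoffel G a k l x * christoffel G k j a x))

/-- `⟨du, dv⟩ = gʲˡ ∂ⱼu ∂ₗv`. -/
def dInner (G : E4 → Matrix (Fin 4) (Fin 4) ℝ) (u v : E4 → ℝ) (x : E4) : ℝ :=
  ∑ j, ∑ l, (G x)⁻¹ j l * pd j u x * pd l v x

/-- The components `∂ᵢ∂ⱼu - Γᵏᵢⱼ ∂ₖu` of the covariant derivative `∇du`. -/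
def hess (G : E4 → Matrix (Fin 4) (Fin 4) ℝ) (u : E4 → ℝ) (i j : Fin 4) (x : E4) : ℝ :=
  pd i (pd j u) x - ∑ k, christoffel G k i j x * pd k u x

/-- The (nonnegative) Laplacian `Δu = -gⁱʲ (∂ᵢ∂ⱼu - Γᵏᵢⱼ ∂ₖu)`. -/
def laplacian (G : E4 → Matrix (Fin 4) (Fin 4) ℝ) (u : E4 → ℝ) (x : E4) : ℝ :=
  -∑ i, ∑ j, (G x)⁻¹ i j * hess G u i j x

/-- `⟨∇du, ∇dv⟩ = gᵇᵖ gˡᵠ (∇du)_{bl} (∇dv)_{pq}`. -/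
def hessInner (G : E4 → Matrix (Fin 4) (Fin 4) ℝ) (u v : E4 → ℝ) (x : E4) : ℝ :=
  ∑ b, ∑ l, ∑ p, ∑ q, (G x)⁻¹ b p * (G x)⁻¹ l q * hess G u b l x * hess G v p q x

/-- The density
`A₄(u,v) = ⅓ r ⟨du,dv⟩ + Δ⟨du,dv⟩ + ⟨∇du,∇dv⟩ - ½ Δu Δv` in coordinates. -/
def coordA4 (G : E4 → Matrix (Fin 4) (Fin 4) ℝ) (u v : E4 → ℝ) (x : E4) : ℝ :=
  (1 / 3) * scalarCurv G x * dInner G u v x + laplacian G (dInner G u v) x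
    + hessInner G u v x - (1 / 2) * laplacian G u x * laplacian G v x

/-- The coefficient of `εʲ` in the Taylor expansion of `φ` at `ε = 0`. -/
def taylorCoeff (j : ℕ) (φ : ℝ → ℝ) : ℝ :=
  iteratedDeriv j φ 0 / (j.factorial : ℝ)

/-! ### Objects on the manifold -/

section Manifold

variable {M : Type*} [TopologicalSpace M] [ChartedSpace E4 M]

variable (M) in
/-- Fields of bilinear forms on the tangent spaces of `M`. -/
abbrev BilinField : Type _ :=
  ∀ p : M, TangentSpace (𝓡 4) p →L[ℝ] TangentSpace (𝓡 4) p →L[ℝ] ℝ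

variable (M) in
/-- Smooth Riemannian metrics on (the tangent bundle of) `M`. -/
abbrev Metric [IsManifold (𝓡 4) ∞ M] : Type _ :=
  Bundle.ContMDiffRiemannianMetric (𝓡 4) ∞ E4 (fun p : M => TangentSpace (𝓡 4) p)

variable (M) in
/-- An orientation of `M`: a family of smooth charts that covers `M`, with all the transition
maps having positive Jacobian determinant. -/
structure OrientedAtlas where
  charts : Set (OpenPartialHomeomorph M E4)
  mem_maximalAtlas : ∀ e ∈ charts, e ∈ IsManifold.maximalAtlas (𝓡 4) ∞ M
  covers : ∀ p : M, ∃ e ∈ charts, p ∈ e.source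
  jacobian_pos : ∀ e ∈ charts, ∀ e' ∈ charts, ∀ p ∈ e.source ∩ e'.source,
    0 < (fderiv ℝ (fun x : E4 => e' (e.symm x)) (e p)).det

/-- The pointwise product `f g`. -/
def scale (f : M → ℝ) (g : BilinField M) : BilinField M := fun p => f p • g p

/-- The linear perturbation `g + ε h`. -/
def perturb (g h : BilinField M) (ε : ℝ) : BilinField M := fun p => g p + ε • h p

/-- The coordinate vector field `∂ᵢ` of the chart `e`, at the point with coordinates `x`. -/
def coordVec (e : OpenPartialHomeomorph M E4) (i : Fin 4) (x : E4) :
    TangentSpace (𝓡 4) (e.symm x) :=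
  mfderiv (𝓡 4) (𝓡 4) e.symm x (EuclideanSpace.single i (1 : ℝ) : E4)

/-- The components `gᵢⱼ = g(∂ᵢ, ∂ⱼ)` of `g` in the chart `e`, as functions of the coordinates. -/
def components (e : OpenPartialHomeomorph M E4) (g : BilinField M) (x : E4) :
    Matrix (Fin 4) (Fin 4) ℝ :=
  Matrix.of fun i j => g (e.symm x) (coordVec e i x) (coordVec e j x)

/-- The value at `p` of the density `A₄(f₁,f₂)_g`, computed in the chart `e`. -/
def connesA4 (e : OpenPartialHomeomorph M E4) (f₁ f₂ : M → ℝ) (g : BilinField M) (p : M) : ℝ :=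
  coordA4 (components e g) (fun x => f₁ (e.symm x)) (fun x => f₂ (e.symm x)) (e p)

/-- `A₄ʲ(f₁,f₂)_{(g,h)}`: the coefficient of `εʲ` in the expansion of `A₄(f₁,f₂)_{g+εh}`. -/
def connesA4Coeff (e : OpenPartialHomeomorph M E4) (f₁ f₂ : M → ℝ) (j : ℕ)
    (g h : BilinField M) (p : M) : ℝ :=
  taylorCoeff j (fun ε => connesA4 e f₁ f₂ (perturb g h ε) p)

/-- The matrix `[g]⁻¹[h]` at `p` in the natural frame of the chart `e`. -/
def relMatrix (e : OpenPartialHomeomorph M E4) (g h : BilinField M) (p : M) :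
    Matrix (Fin 4) (Fin 4) ℝ :=
  (components e g (e p))⁻¹ * components e h (e p)

/-- The coefficient `c_l` of `εˡ` in the expansion of `√det(I + ε [g]⁻¹[h])`. -/
def volCoeff (e : OpenPartialHomeomorph M E4) (l : ℕ) (g h : BilinField M) (p : M) : ℝ :=
  taylorCoeff l (fun ε => Real.sqrt (1 + ε • relMatrix e g h p).det)

/-- The form `dx₁ ∧ dx₂ ∧ dx₃ ∧ dx₄` of the chart `e` at `p`. -/
def dxForm (e : OpenPartialHomeomorph M E4) (p : M) :
    TangentSpace (𝓡 4) p [⋀^Fin 4]→ₗ[ℝ] ℝ :=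
  (EuclideanSpace.basisFun (Fin 4) ℝ).toBasis.det.compLinearMap
    (mfderiv (𝓡 4) (𝓡 4) e p).toLinearMap

/-- The volume form `dVol_g = √det[g] dx₁ ∧ dx₂ ∧ dx₃ ∧ dx₄` at `p`, in a positively oriented
chart `e`. -/
def volForm (e : OpenPartialHomeomorph M E4) (g : BilinField M) (p : M) :
    TangentSpace (𝓡 4) p [⋀^Fin 4]→ₗ[ℝ] ℝ :=
  Real.sqrt (components e g (e p)).det • dxForm e p

/-- The 4-form `A₄ʲ(f₁,f₂)_{(g,h)} c_l dVol_g` on the domain of the chart `e`. -/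
def bimetricForm (e : OpenPartialHomeomorph M E4) (f₁ f₂ : M → ℝ) (j l : ℕ)
    (g h : BilinField M) (p : e.source) :
    TangentSpace (𝓡 4) (p : M) [⋀^Fin 4]→ₗ[ℝ] ℝ :=
  (connesA4Coeff e f₁ f₂ j g h p * volCoeff e l g h p) • volForm e g p

/-- A quantity `F` depending on two metrics is a bimetric conformal invariant if
`F(f g, f h) = F(g, h)` for all Riemannian metrics `g`, `h` and every positive smooth `f`. -/
def IsBimetricConformalInvariant [IsManifold (𝓡 4) ∞ M] {X : Sort*}
    (F : BilinField M → BilinField M → X) : Prop :=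
  ∀ (g h : Metric M) (f : C^∞⟮𝓡 4, M; 𝓘(ℝ), ℝ⟯), (∀ p, 0 < f p) →
    F (scale f g.inner) (scale f h.inner) = F g.inner h.inner

end Manifold

end Bimetric

end

/-!
The density `A₄(f₁, f₂)_g` has conformal weight `-4`: for `g' = e²ᵘ g` one has
`A₄(f₁, f₂)_{g'} = e⁻⁴ᵘ A₄(f₁, f₂)_g` (`IsMetricOn.coordA4_conformal`). The connection changes by
the tensor `δᵏᵢ uⱼ + δᵏⱼ uᵢ - gᵢⱼ uᵏ` (`conformalShift`), so that in dimension four, with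
`w = ⟨df₁, df₂⟩`,

* `r' = e⁻²ᵘ (r + 6 Δu - 6 |du|²)`,
* `Δ'w' = e⁻⁴ᵘ (Δw + 2 ⟨du, dw⟩ - 2 w Δu)`, where `w' = e⁻²ᵘ w`,
* `⟨∇'df₁, ∇'df₂⟩' = e⁻⁴ᵘ (⟨∇df₁, ∇df₂⟩ - 2 ⟨du, dw⟩ - ⟨du, df₂⟩ Δf₁ - ⟨du, df₁⟩ Δf₂ + 2 |du|² w
    + 2 ⟨du, df₁⟩ ⟨du, df₂⟩)`,
* `Δ'f = e⁻²ᵘ (Δf - 2 ⟨du, df⟩)`,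

and all the terms in `du` cancel in `A₄`. The third formula uses that
`⟨du, dw⟩ = (∇df₁)(∇u, ∇f₂) + (∇df₂)(∇u, ∇f₁)` (`IsMetricOn.dInner_dInner`), which expresses the
compatibility of the connection with the metric.

Multiplying two metrics `g` and `h` by the same positive function `f = e²ᵘ` multiplies every
`g + ε h` by `f`. For small `ε` this is a nondegenerate symmetric form near the given point, which
is all that the computation needs, so every Taylor coefficient of `A₄` is multiplied by `f⁻²`. The
matrix `[g]⁻¹[h]`, hence `c_l`, does not change, and `√det [g]` is multiplied by `f²`
(`bimetricForm_scale`).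

The expansions are Taylor's theorem. The density depends smoothly on `ε` near `0`, because
the pairs `(ε, y)` at which `g + ε h` is nondegenerate form an open set, on which all the tensors
involved are jointly smooth in `(ε, y)` (`smoothFamilyOn_coordA4`), and `c₁`, `c₂` come from
`det(1 + ε A) = 1 + (tr A) ε + e₂(A) ε² + O(ε³)`.
-/

noncomputable section

namespace Bimetric

/-! ### Taylor coefficients -/

theorem sub_taylorCoeff_isBigO {φ : ℝ → ℝ} (h : ContDiffAt ℝ 3 φ 0) :
    (fun ε : ℝ => φ ε - (taylorCoeff 0 φ + taylorCoeff 1 φ * ε + taylorCoeff 2 φ * ε ^ 2))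
      =O[𝓝 0] (fun ε : ℝ => ε ^ 3) := by
  obtain ⟨u, hu, hφu⟩ := h.contDiffOn (m := 3) le_rfl (by simp)
  obtain ⟨r, hr, hru⟩ := _root_.Metric.mem_nhds_iff.1 (by simpa using hu)
  have hφ : ContDiffOn ℝ (3 : ℕ) φ (_root_.Metric.ball 0 r) := hφu.mono hru
  have h0 : (0 : ℝ) ∈ _root_.Metric.ball (0 : ℝ) r := _root_.Metric.mem_ball_self hr
  have key := (taylor_isLittleO (convex_ball (0 : ℝ) r) h0 hφ).isBigO
  rw [_root_.Metric.isOpen_ball.nhdsWithin_eq h0] at key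
  simp only [sub_zero] at key
  have hw : ∀ n, iteratedDerivWithin n φ (_root_.Metric.ball 0 r) 0 = iteratedDeriv n φ 0 :=
    fun n => iteratedDerivWithin_of_isOpen _root_.Metric.isOpen_ball h0
  refine (key.add ((Asymptotics.isBigO_refl (fun ε : ℝ => ε ^ 3) (𝓝 0)).const_mul_left
    (taylorCoeff 3 φ))).congr_left fun ε => ?_
  rw [taylor_within_apply]
  simp only [hw, Finset.sum_range_succ, Finset.sum_range_zero, taylorCoeff, smul_eq_mul, sub_zero]
  ring

theorem taylorCoeff_congr {φ ψ : ℝ → ℝ} (h : φ =ᶠ[𝓝 0] ψ) (j : ℕ) :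
    taylorCoeff j φ = taylorCoeff j ψ := by
  rw [taylorCoeff, taylorCoeff, h.iteratedDeriv_eq]

theorem taylorCoeff_const_mul {φ : ℝ → ℝ} (c : ℝ) (j : ℕ) :
    taylorCoeff j (fun ε => c * φ ε) = c * taylorCoeff j φ := by
  rw [taylorCoeff, taylorCoeff, iteratedDeriv_const_mul_field, mul_div_assoc]

theorem taylorCoeff_zero (φ : ℝ → ℝ) : taylorCoeff 0 φ = φ 0 := by
  simp [taylorCoeff]

theorem taylorCoeff_one (φ : ℝ → ℝ) : taylorCoeff 1 φ = deriv φ 0 := by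
  simp [taylorCoeff]

theorem taylorCoeff_two (φ : ℝ → ℝ) : taylorCoeff 2 φ = deriv (deriv φ) 0 / 2 := by
  simp [taylorCoeff, iteratedDeriv_succ]

/-! ### The expansion of `√det(I + ε A)` -/

/-- The polynomial `det(1 + ε A)`. Only its coefficients of degree at most two matter for the
expansion of its square root to second order. -/
theorem exists_det_one_add_smul (A : Matrix (Fin 4) (Fin 4) ℝ) : ∃ c d : ℝ, ∀ ε : ℝ,
    (1 + ε • A).det = 1 + (∑ i, A i i) * ε
      + ((∑ i, ∑ k ∈ Finset.Ioi i, A i i * A k k) - ∑ i, ∑ k ∈ Finset.Ioi i, A i k * A k i)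
        * ε ^ 2 + c * ε ^ 3 + d * ε ^ 4 := by
  have h0 : Finset.Ioi (0 : Fin 4) = {1, 2, 3} := by decide
  have h1 : Finset.Ioi (1 : Fin 4) = {2, 3} := by decide
  have h2 : Finset.Ioi (2 : Fin 4) = {3} := by decide
  have h3 : Finset.Ioi (3 : Fin 4) = ∅ := by decide
  -- the coefficient of `ε³` is the sum of the principal `3 × 3` minors
  refine ⟨∑ i : Fin 4, (A.submatrix i.succAbove i.succAbove).det, A.det, fun ε => ?_⟩
  simp [h0, Matrix.det_succ_row_zero, Fin.sum_univ_succ,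
    Fin.succAbove, Matrix.one_apply]
  ring

section SqrtQuartic

variable (a b c d : ℝ)

theorem hasDerivAt_quartic (ε : ℝ) :
    HasDerivAt (fun ε : ℝ => 1 + a * ε + b * ε ^ 2 + c * ε ^ 3 + d * ε ^ 4)
      (a + 2 * b * ε + 3 * c * ε ^ 2 + 4 * d * ε ^ 3) ε := by
  have := (((((hasDerivAt_id ε).const_mul a).const_add 1).add
    ((hasDerivAt_pow 2 ε).const_mul b)).add ((hasDerivAt_pow 3 ε).const_mul c)).add
    ((hasDerivAt_pow 4 ε).const_mul d)
  convert! this using 1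
  simp
  ring

theorem deriv_sqrt_quartic_eventuallyEq :
    deriv (fun ε : ℝ => √(1 + a * ε + b * ε ^ 2 + c * ε ^ 3 + d * ε ^ 4)) =ᶠ[𝓝 0]
      fun ε => (a + 2 * b * ε + 3 * c * ε ^ 2 + 4 * d * ε ^ 3) /
        (2 * √(1 + a * ε + b * ε ^ 2 + c * ε ^ 3 + d * ε ^ 4)) := by
  have hc : ContinuousAt (fun ε : ℝ => 1 + a * ε + b * ε ^ 2 + c * ε ^ 3 + d * ε ^ 4) 0 :=
    (hasDerivAt_quartic a b c d 0).continuousAt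
  filter_upwards [hc.eventually_ne (y := 0) (by simp)] with ε hε
  exact ((hasDerivAt_quartic a b c d ε).sqrt hε).deriv

theorem taylorCoeff_one_sqrt_quartic :
    taylorCoeff 1 (fun ε => √(1 + a * ε + b * ε ^ 2 + c * ε ^ 3 + d * ε ^ 4)) = a / 2 := by
  rw [taylorCoeff_one, (deriv_sqrt_quartic_eventuallyEq a b c d).self_of_nhds]
  simp

theorem taylorCoeff_two_sqrt_quartic :
    taylorCoeff 2 (fun ε => √(1 + a * ε + b * ε ^ 2 + c * ε ^ 3 + d * ε ^ 4))
      = b / 2 - a ^ 2 / 8 := by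
  have h1 : HasDerivAt (fun ε : ℝ => a + 2 * b * ε + 3 * c * ε ^ 2 + 4 * d * ε ^ 3) (2 * b) 0 := by
    have := (((hasDerivAt_id (0 : ℝ)).const_mul (2 * b)).const_add a).add
      ((hasDerivAt_pow 2 (0 : ℝ)).const_mul (3 * c)) |>.add
      ((hasDerivAt_pow 3 (0 : ℝ)).const_mul (4 * d))
    convert! this using 1
    simp
  have h2 := ((hasDerivAt_quartic a b c d 0).sqrt (by simp)).const_mul 2
  rw [taylorCoeff_two, (deriv_sqrt_quartic_eventuallyEq a b c d).deriv_eq,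
    (h1.fun_div h2 (by simp)).deriv]
  simp
  ring

end SqrtQuartic

/-- The first coefficients of `√det(1 + ε A)`, with the remainder. -/
theorem sqrt_det_one_add_smul_expansion (A : Matrix (Fin 4) (Fin 4) ℝ) :
    (fun ε : ℝ => √(1 + ε • A).det
        - (1 + taylorCoeff 1 (fun ε => √(1 + ε • A).det) * ε
          + taylorCoeff 2 (fun ε => √(1 + ε • A).det) * ε ^ 2)) =O[𝓝 0] (fun ε : ℝ => ε ^ 3) ∧
      taylorCoeff 0 (fun ε => √(1 + ε • A).det) = 1 ∧
      taylorCoeff 1 (fun ε => √(1 + ε • A).det) = (∑ i, A i i) / 2 ∧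
      taylorCoeff 2 (fun ε => √(1 + ε • A).det)
        = (1 / 2) * ((∑ i, ∑ k ∈ Finset.Ioi i, A i i * A k k)
          - ∑ i, ∑ k ∈ Finset.Ioi i, A i k * A k i) - (1 / 8) * (∑ i, A i i) ^ 2 := by
  obtain ⟨c, d, hcd⟩ := exists_det_one_add_smul A
  simp only [hcd]
  set a := ∑ i, A i i
  set b := (∑ i, ∑ k ∈ Finset.Ioi i, A i i * A k k) - ∑ i, ∑ k ∈ Finset.Ioi i, A i k * A k i
  have h0 : taylorCoeff 0 (fun ε => √(1 + a * ε + b * ε ^ 2 + c * ε ^ 3 + d * ε ^ 4)) = 1 := by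
    simp [taylorCoeff_zero]
  refine ⟨?_, h0, taylorCoeff_one_sqrt_quartic a b c d, ?_⟩
  · have hs : ContDiffAt ℝ 3 (fun ε => √(1 + a * ε + b * ε ^ 2 + c * ε ^ 3 + d * ε ^ 4)) 0 := by
      refine ContDiffAt.sqrt ?_ (by simp)
      fun_prop
    have := sub_taylorCoeff_isBigO hs
    rwa [h0] at this
  · rw [taylorCoeff_two_sqrt_quartic]
    ring

/-- The Gram matrix of the images of the standard basis vectors computes the pulled back
bilinear form. -/
theorem dotProduct_gram_mulVec {F : Type*} [AddCommGroup F] [Module ℝ F] [TopologicalSpace F]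
    [IsTopologicalAddGroup F] [ContinuousSMul ℝ F]
    (B : F →L[ℝ] F →L[ℝ] ℝ) (D : E4 →L[ℝ] F) (v : Fin 4 → ℝ) :
    star v ⬝ᵥ (Matrix.of fun i j => B (D (EuclideanSpace.single i (1 : ℝ)))
      (D (EuclideanSpace.single j (1 : ℝ)))).mulVec v
      = B (D (WithLp.toLp 2 v)) (D (WithLp.toLp 2 v)) := by
  have hv : (WithLp.toLp 2 v : E4) = ∑ i, v i • (EuclideanSpace.single i (1 : ℝ) : E4) := by
    ext j
    simp [Pi.single_apply]
  rw [hv]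
  simp only [map_sum, map_smul, FunLike.coe_sum, FunLike.coe_smul,
    Finset.sum_apply, Pi.smul_apply, smul_eq_mul, Matrix.mulVec, dotProduct, Matrix.of_apply,
    Finset.mul_sum, star_trivial]
  rw [Finset.sum_comm]
  exact Finset.sum_congr rfl fun i _ => Finset.sum_congr rfl fun j _ => by ring

/-! ### Components of a metric in a chart -/

section Chart

variable {M : Type*} [TopologicalSpace M] [ChartedSpace E4 M]

theorem components_scale (e : OpenPartialHomeomorph M E4) (f : M → ℝ) (g : BilinField M) (x : E4) :
    components e (scale f g) x = f (e.symm x) • components e g x := by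
  ext i j
  simp [components, scale]

theorem components_perturb (e : OpenPartialHomeomorph M E4) (g h : BilinField M) (ε : ℝ) (x : E4) :
    components e (perturb g h ε) x = components e g x + ε • components e h x := by
  ext i j
  simp [components, perturb]

theorem contDiffOn_comp_symm {e : OpenPartialHomeomorph M E4}
    (he : e ∈ IsManifold.maximalAtlas (𝓡 4) ∞ M)
    (f : C^∞⟮𝓡 4, M; 𝓘(ℝ), ℝ⟯) : ContDiffOn ℝ ∞ (fun x => f (e.symm x)) e.target := by
  rw [← contMDiffOn_iff_contDiffOn]
  exact f.contMDiff.comp_contMDiffOn (contMDiffOn_symm_of_mem_maximalAtlas he)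

variable [IsManifold (𝓡 4) ∞ M]

theorem components_symm (e : OpenPartialHomeomorph M E4) (g : Metric M) (x : E4) (i j : Fin 4) :
    components e g.inner x i j = components e g.inner x j i := by
  simp only [components, Matrix.of_apply]
  exact g.symm _ _ _

variable {e : OpenPartialHomeomorph M E4}

theorem contMDiffOn_coordVec (he : e ∈ IsManifold.maximalAtlas (𝓡 4) ∞ M) (i : Fin 4) :
    ContMDiffOn (𝓡 4) ((𝓡 4).prod 𝓘(ℝ, E4)) ∞
      (fun x => (Bundle.TotalSpace.mk' E4 (e.symm x) (coordVec e i x) : TangentBundle (𝓡 4) M))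
      e.target := by
  have : IsManifold (𝓡 4) 1 M := IsManifold.of_le (n := ∞) (by simp)
  have h1 := (contMDiffOn_symm_of_mem_maximalAtlas he).contMDiffOn_tangentMapWithin (m := ∞)
    (by simp) e.open_target.uniqueMDiffOn
  have h2 : ContMDiff (𝓡 4) ((𝓡 4).prod 𝓘(ℝ, E4)) ∞
      (fun x : E4 => (Bundle.TotalSpace.mk' E4 x (EuclideanSpace.single i (1 : ℝ) : E4)
        : TangentBundle 𝓘(ℝ, E4) E4)) :=
    contMDiff_vectorSpace_iff_contDiff.2 contDiff_const
  refine (h1.comp h2.contMDiffOn (fun x hx => hx)).congr fun x hx => ?_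
  simp only [Function.comp, tangentMapWithin, coordVec]
  rw [mfderivWithin_of_isOpen e.open_target hx]

theorem contDiffOn_components (he : e ∈ IsManifold.maximalAtlas (𝓡 4) ∞ M) (g : Metric M)
    (i j : Fin 4) : ContDiffOn ℝ ∞ (fun x => components e g.inner x i j) e.target := by
  rw [← contMDiffOn_iff_contDiffOn]
  intro x hx
  have := ContMDiffWithinAt.clm_bundle_apply₂ (F₁ := E4) (F₂ := E4) (F₃ := ℝ)
    (E₃ := Bundle.Trivial M ℝ) (b := e.symm)
    (g.contMDiff.contMDiffAt.comp_contMDiffWithinAt x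
      (contMDiffOn_symm_of_mem_maximalAtlas he x hx))
    (contMDiffOn_coordVec he i x hx) (contMDiffOn_coordVec he j x hx)
  simp only [Bundle.contMDiffWithinAt_totalSpace] at this
  exact this.2

theorem posDef_components (he : e ∈ IsManifold.maximalAtlas (𝓡 4) ∞ M) (g : Metric M) {x : E4}
    (hx : x ∈ e.target) : (components e g.inner x).PosDef := by
  have : IsManifold (𝓡 4) 1 M := IsManifold.of_le (n := ∞) (by simp)
  have he1 : e ∈ IsManifold.maximalAtlas (𝓡 4) 1 M :=
    IsManifold.maximalAtlas_subset_of_le (by simp) he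
  have hd : e.MDifferentiable (𝓡 4) (𝓡 4) :=
    ⟨fun y hy => (mdifferentiableAt_of_mem_maximalAtlas he1 hy).mdifferentiableWithinAt,
      fun y hy => (mdifferentiableAt_symm_of_mem_maximalAtlas he1 hy).mdifferentiableWithinAt⟩
  refine Matrix.PosDef.of_dotProduct_mulVec_pos ?_ fun {v} hv => ?_
  · ext i j
    simpa using components_symm e g x j i
  · have hne : mfderiv (𝓡 4) (𝓡 4) e.symm x (WithLp.toLp 2 v : E4) ≠ 0 := by
      intro h
      have := hd.symm.mfderiv_injective hx (h.trans (map_zero _).symm)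
      exact hv ((WithLp.toLp_eq_zero 2).1 this)
    exact (g.pos _ _ hne).trans_eq (dotProduct_gram_mulVec (F := TangentSpace (𝓡 4) (e.symm x))
      _ (mfderiv (𝓡 4) (𝓡 4) e.symm x) v).symm

theorem det_components_pos (he : e ∈ IsManifold.maximalAtlas (𝓡 4) ∞ M) (g : Metric M) {x : E4}
    (hx : x ∈ e.target) : 0 < (components e g.inner x).det :=
  (posDef_components he g hx).det_pos

end Chart

/-! ### Partial derivatives -/

section PartialDerivatives

variable {u v : E4 → ℝ} {x : E4} {U : Set E4}

theorem pd_congr (hU : IsOpen U) (h : Set.EqOn u v U) (i : Fin 4) : Set.EqOn (pd i u) (pd i v) U :=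
  fun x hx => by rw [pd, pd, (h.eventuallyEq_of_mem (hU.mem_nhds hx)).fderiv_eq]

theorem pd_const (i : Fin 4) (c : ℝ) (x : E4) : pd i (fun _ => c) x = 0 := by
  simp [pd]

theorem pd_add (hu : DifferentiableAt ℝ u x) (hv : DifferentiableAt ℝ v x) (i : Fin 4) :
    pd i (fun y => u y + v y) x = pd i u x + pd i v x := by
  simp [pd, fderiv_fun_add hu hv]

theorem pd_sub (hu : DifferentiableAt ℝ u x) (hv : DifferentiableAt ℝ v x) (i : Fin 4) :
    pd i (fun y => u y - v y) x = pd i u x - pd i v x := by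
  simp [pd, fderiv_fun_sub hu hv]

theorem pd_mul (hu : DifferentiableAt ℝ u x) (hv : DifferentiableAt ℝ v x) (i : Fin 4) :
    pd i (fun y => u y * v y) x = pd i u x * v x + u x * pd i v x := by
  simp [pd, fderiv_fun_mul hu hv]
  ring

theorem pd_const_mul (hu : DifferentiableAt ℝ u x) (c : ℝ) (i : Fin 4) :
    pd i (fun y => c * u y) x = c * pd i u x := by
  simp [pd, fderiv_const_mul hu]

theorem pd_sum {ι : Type*} (s : Finset ι) {F : ι → E4 → ℝ}
    (hF : ∀ k ∈ s, DifferentiableAt ℝ (F k) x) (i : Fin 4) :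
    pd i (fun y => ∑ k ∈ s, F k y) x = ∑ k ∈ s, pd i (F k) x := by
  simp [pd, fderiv_fun_sum hF]

theorem pd_sum_mul {ι : Type*} (s : Finset ι) {F H : ι → E4 → ℝ}
    (hF : ∀ k, DifferentiableAt ℝ (F k) x) (hH : ∀ k, DifferentiableAt ℝ (H k) x) (i : Fin 4) :
    pd i (fun y => ∑ k ∈ s, F k y * H k y) x
      = ∑ k ∈ s, (pd i (F k) x * H k x + F k x * pd i (H k) x) := by
  rw [pd_sum s fun k _ => (hF k).fun_mul (hH k)]
  exact Finset.sum_congr rfl fun k _ => pd_mul (hF k) (hH k) i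

theorem pd_exp (hu : DifferentiableAt ℝ u x) (i : Fin 4) :
    pd i (fun y => Real.exp (u y)) x = Real.exp (u x) * pd i u x := by
  simp [pd, fderiv_exp hu]

theorem pd_pd_comm (hu : ContDiffAt ℝ ∞ u x) (i j : Fin 4) :
    pd i (pd j u) x = pd j (pd i u) x := by
  have h2 : ContDiffAt ℝ 2 u x := hu.of_le (WithTop.coe_le_coe.2 le_top)
  have hd : DifferentiableAt ℝ (fderiv ℝ u) x :=
    (h2.fderiv_right (m := 1) one_add_one_eq_two.le).differentiableAt one_ne_zero
  have key : ∀ k l : Fin 4, pd k (pd l u) x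
      = fderiv ℝ (fderiv ℝ u) x (EuclideanSpace.single k 1) (EuclideanSpace.single l 1) := by
    intro k l
    have : pd l u = fun y => fderiv ℝ u y (EuclideanSpace.single l 1) := rfl
    rw [pd, this, fderiv_clm_apply hd (differentiableAt_const _)]
    simp
  rw [key, key]
  exact (h2.isSymmSndFDerivAt (by simp)).eq _ _

end PartialDerivatives

/-! ### Smooth families of tensor components -/

section Families

/-- A family `F ε` of functions on `E4`, jointly smooth in the parameter and the point over the
set `W` of pairs `(ε, y)`. -/
def SmoothFamilyOn (W : Set (ℝ × E4)) (F : ℝ → E4 → ℝ) : Prop :=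
  ContDiffOn ℝ ∞ (fun z : ℝ × E4 => F z.1 z.2) W

variable {W : Set (ℝ × E4)} {F H : ℝ → E4 → ℝ}

theorem smoothFamilyOn_const {U : Set E4} {u : E4 → ℝ} :
    SmoothFamilyOn (Prod.snd ⁻¹' U) (fun _ => u) ↔ ContDiffOn ℝ ∞ u U :=
  ⟨fun h => h.comp (contDiff_const.prodMk contDiff_id (f := fun _ : E4 => (0 : ℝ))).contDiffOn
    fun _ hy => hy, fun h => h.comp contDiff_snd.contDiffOn fun _ hz => hz⟩

namespace SmoothFamilyOn

theorem mono {W' : Set (ℝ × E4)} (h : SmoothFamilyOn W F) (hW : W' ⊆ W) : SmoothFamilyOn W' F :=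
  ContDiffOn.mono h hW

theorem const (c : ℝ) : SmoothFamilyOn W (fun _ _ => c) := contDiffOn_const

theorem add (hF : SmoothFamilyOn W F) (hH : SmoothFamilyOn W H) :
    SmoothFamilyOn W (fun ε y => F ε y + H ε y) := ContDiffOn.add hF hH

theorem sub (hF : SmoothFamilyOn W F) (hH : SmoothFamilyOn W H) :
    SmoothFamilyOn W (fun ε y => F ε y - H ε y) := ContDiffOn.sub hF hH

theorem mul (hF : SmoothFamilyOn W F) (hH : SmoothFamilyOn W H) :
    SmoothFamilyOn W (fun ε y => F ε y * H ε y) := ContDiffOn.mul hF hH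

theorem neg (hF : SmoothFamilyOn W F) : SmoothFamilyOn W (fun ε y => -F ε y) := ContDiffOn.neg hF

theorem sum {ι : Type*} {s : Finset ι} {F : ι → ℝ → E4 → ℝ}
    (hF : ∀ k ∈ s, SmoothFamilyOn W (F k)) :
    SmoothFamilyOn W (fun ε y => ∑ k ∈ s, F k ε y) := ContDiffOn.sum hF

theorem prod {ι : Type*} {s : Finset ι} {F : ι → ℝ → E4 → ℝ}
    (hF : ∀ k ∈ s, SmoothFamilyOn W (F k)) :
    SmoothFamilyOn W (fun ε y => ∏ k ∈ s, F k ε y) := contDiffOn_prod hF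

theorem contDiffAt_param (hW : IsOpen W) (hF : SmoothFamilyOn W F) {ε : ℝ} {x : E4}
    (hx : (ε, x) ∈ W) : ContDiffAt ℝ ∞ (fun ε => F ε x) ε := by
  have h1 : ContDiffAt ℝ ∞ (fun z : ℝ × E4 => F z.1 z.2) (ε, x) :=
    ContDiffOn.contDiffAt hF (hW.mem_nhds hx)
  have h2 : ContDiffAt ℝ ∞ (fun ε : ℝ => (ε, x)) ε := contDiffAt_id.prodMk contDiffAt_const
  exact h1.comp ε h2

theorem contDiffOn_slice (hF : SmoothFamilyOn W F) (ε : ℝ) :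
    ContDiffOn ℝ ∞ (F ε) {y | (ε, y) ∈ W} := by
  have h2 : ContDiff ℝ ∞ (fun y : E4 => (ε, y)) := contDiff_const.prodMk contDiff_id
  exact ContDiffOn.comp (g := fun z : ℝ × E4 => F z.1 z.2) hF h2.contDiffOn fun y hy => hy

/-- Partial derivatives in the point preserve joint smoothness, being directional derivatives of
the function of the pair `(ε, y)`. -/
theorem pd (hW : IsOpen W) (hF : SmoothFamilyOn W F) (i : Fin 4) :
    SmoothFamilyOn W (fun ε => pd i (F ε)) := by
  have h : ContDiffOn ℝ ∞ (fun z : ℝ × E4 => fderiv ℝ (fun z : ℝ × E4 => F z.1 z.2) z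
      (0, EuclideanSpace.single i 1)) W :=
    (ContDiffOn.fderiv_of_isOpen hF hW (by simp)).clm_apply contDiffOn_const
  refine ContDiffOn.congr h fun z hz => ?_
  have hd : DifferentiableAt ℝ (fun z : ℝ × E4 => F z.1 z.2) (z.1, z.2) :=
    (ContDiffOn.contDiffAt hF (hW.mem_nhds hz)).differentiableAt (by simp)
  have := hd.hasFDerivAt.comp z.2 (hasFDerivAt_prodMk_right z.1 z.2)
  have e : fderiv ℝ (F z.1) z.2 = _ := this.fderiv
  simp [Bimetric.pd, e]

end SmoothFamilyOn

variable {G : ℝ → E4 → Matrix (Fin 4) (Fin 4) ℝ}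

theorem smoothFamilyOn_det (hG : ∀ i j, SmoothFamilyOn W (fun ε y => G ε y i j)) :
    SmoothFamilyOn W (fun ε y => (G ε y).det) := by
  simp only [Matrix.det_apply']
  exact .sum fun σ _ => (SmoothFamilyOn.const _).mul (.prod fun i _ => hG _ _)

theorem smoothFamilyOn_inv (hG : ∀ i j, SmoothFamilyOn W (fun ε y => G ε y i j))
    (hdet : ∀ z ∈ W, (G z.1 z.2).det ≠ 0) (i j : Fin 4) :
    SmoothFamilyOn W (fun ε y => (G ε y)⁻¹ i j) := by
  simp only [Matrix.inv_def, Ring.inverse_eq_inv', Matrix.smul_apply, smul_eq_mul,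
    Matrix.adjugate_apply]
  refine SmoothFamilyOn.mul (ContDiffOn.inv (smoothFamilyOn_det hG) hdet)
    (smoothFamilyOn_det fun k l => ?_)
  simp only [Matrix.updateRow_apply]
  split_ifs
  · exact .const _
  · exact hG k l

variable (hW : IsOpen W) (hG : ∀ i j, SmoothFamilyOn W (fun ε y => G ε y i j))
  (hdet : ∀ z ∈ W, (G z.1 z.2).det ≠ 0)

include hW hG hdet

theorem smoothFamilyOn_christoffel (k i j : Fin 4) :
    SmoothFamilyOn W (fun ε => christoffel (G ε) k i j) :=
  (SmoothFamilyOn.const _).mul (.sum fun l _ => (smoothFamilyOn_inv hG hdet k l).mul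
    ((((hG i l).pd hW j).add ((hG j l).pd hW i)).sub ((hG i j).pd hW l)))

theorem smoothFamilyOn_scalarCurv : SmoothFamilyOn W (fun ε => scalarCurv (G ε)) := by
  have hΓ := smoothFamilyOn_christoffel hW hG hdet
  exact .sum fun j _ => .sum fun l _ => (smoothFamilyOn_inv hG hdet j l).mul
    (.sum fun k _ => (((hΓ k j l).pd hW k).sub ((hΓ k k l).pd hW j)).add
      (.sum fun a _ => ((hΓ a j l).mul (hΓ k k a)).sub ((hΓ a k l).mul (hΓ k j a))))

theorem smoothFamilyOn_dInner (hF : SmoothFamilyOn W F) (hH : SmoothFamilyOn W H) :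
    SmoothFamilyOn W (fun ε => dInner (G ε) (F ε) (H ε)) :=
  .sum fun j _ => .sum fun l _ =>
    ((smoothFamilyOn_inv hG hdet j l).mul (hF.pd hW j)).mul (hH.pd hW l)

theorem smoothFamilyOn_hess (hF : SmoothFamilyOn W F) (i j : Fin 4) :
    SmoothFamilyOn W (fun ε => hess (G ε) (F ε) i j) :=
  ((hF.pd hW j).pd hW i).sub (.sum fun k _ =>
    (smoothFamilyOn_christoffel hW hG hdet k i j).mul (hF.pd hW k))

theorem smoothFamilyOn_laplacian (hF : SmoothFamilyOn W F) :
    SmoothFamilyOn W (fun ε => laplacian (G ε) (F ε)) :=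
  SmoothFamilyOn.neg (.sum fun i _ => .sum fun j _ => (smoothFamilyOn_inv hG hdet i j).mul
    (smoothFamilyOn_hess hW hG hdet hF i j))

theorem smoothFamilyOn_hessInner (hF : SmoothFamilyOn W F) (hH : SmoothFamilyOn W H) :
    SmoothFamilyOn W (fun ε => hessInner (G ε) (F ε) (H ε)) :=
  .sum fun b _ => .sum fun l _ => .sum fun p _ => .sum fun q _ =>
    (((smoothFamilyOn_inv hG hdet b p).mul (smoothFamilyOn_inv hG hdet l q)).mul
      (smoothFamilyOn_hess hW hG hdet hF b l)).mul (smoothFamilyOn_hess hW hG hdet hH p q)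

theorem smoothFamilyOn_coordA4 (hF : SmoothFamilyOn W F) (hH : SmoothFamilyOn W H) :
    SmoothFamilyOn W (fun ε => coordA4 (G ε) (F ε) (H ε)) :=
  (((((SmoothFamilyOn.const _).mul (smoothFamilyOn_scalarCurv hW hG hdet)).mul
    (smoothFamilyOn_dInner hW hG hdet hF hH)).add
    (smoothFamilyOn_laplacian hW hG hdet (smoothFamilyOn_dInner hW hG hdet hF hH))).add
    (smoothFamilyOn_hessInner hW hG hdet hF hH)).sub
    (((SmoothFamilyOn.const _).mul (smoothFamilyOn_laplacian hW hG hdet hF)).mul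
      (smoothFamilyOn_laplacian hW hG hdet hH))

end Families

/-! ### Smooth metrics in coordinates -/

/-- The components of a smooth pseudo-Riemannian metric on the open set `U`. -/
structure IsMetricOn (U : Set E4) (G : E4 → Matrix (Fin 4) (Fin 4) ℝ) : Prop where
  isOpen : IsOpen U
  smooth : ∀ i j, ContDiffOn ℝ ∞ (fun y => G y i j) U
  symm : ∀ y ∈ U, ∀ i j, G y i j = G y j i
  det_ne_zero : ∀ y ∈ U, (G y).det ≠ 0

/-- The components `gᵏˡ ∂ₗu` of the gradient of `u`. -/
def gradComp (G : E4 → Matrix (Fin 4) (Fin 4) ℝ) (u : E4 → ℝ) (k : Fin 4) (x : E4) : ℝ :=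
  ∑ l, (G x)⁻¹ k l * pd l u x

section Metric

variable {U : Set E4} {G : E4 → Matrix (Fin 4) (Fin 4) ℝ} {u v : E4 → ℝ} {x : E4}

theorem dInner_eq_sum_gradComp (G : E4 → Matrix (Fin 4) (Fin 4) ℝ) (u v : E4 → ℝ) (x : E4) :
    dInner G u v x = ∑ j, pd j u x * gradComp G v j x := by
  simp only [dInner, gradComp, Finset.mul_sum]
  exact Finset.sum_congr rfl fun j _ => Finset.sum_congr rfl fun l _ => by ring

theorem differentiableAt_of_contDiffOn (hU : IsOpen U) (hu : ContDiffOn ℝ ∞ u U) (hx : x ∈ U) :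
    DifferentiableAt ℝ u x :=
  (hu.contDiffAt (hU.mem_nhds hx)).differentiableAt (by simp)

theorem contDiffOn_pd (hU : IsOpen U) (hu : ContDiffOn ℝ ∞ u U) (i : Fin 4) :
    ContDiffOn ℝ ∞ (pd i u) U :=
  smoothFamilyOn_const.1 ((smoothFamilyOn_const.2 hu).pd (hU.preimage continuous_snd) i)

namespace IsMetricOn

section

variable (hG : IsMetricOn U G)

include hG

theorem contDiffOn_inv (i j : Fin 4) : ContDiffOn ℝ ∞ (fun y => (G y)⁻¹ i j) U :=
  smoothFamilyOn_const.1 (smoothFamilyOn_inv (fun i j => smoothFamilyOn_const.2 (hG.smooth i j))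
    (fun z hz => hG.det_ne_zero z.2 hz) i j)

theorem contDiffOn_christoffel (k i j : Fin 4) : ContDiffOn ℝ ∞ (christoffel G k i j) U :=
  smoothFamilyOn_const.1 (smoothFamilyOn_christoffel (hG.isOpen.preimage continuous_snd)
    (fun i j => smoothFamilyOn_const.2 (hG.smooth i j))
    (fun z hz => hG.det_ne_zero z.2 hz) k i j)

theorem contDiffOn_dInner (hu : ContDiffOn ℝ ∞ u U) (hv : ContDiffOn ℝ ∞ v U) :
    ContDiffOn ℝ ∞ (dInner G u v) U :=
  smoothFamilyOn_const.1 (smoothFamilyOn_dInner (hG.isOpen.preimage continuous_snd)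
    (fun i j => smoothFamilyOn_const.2 (hG.smooth i j))
    (fun z hz => hG.det_ne_zero z.2 hz) (smoothFamilyOn_const.2 hu) (smoothFamilyOn_const.2 hv))

theorem contDiffOn_gradComp (hu : ContDiffOn ℝ ∞ u U) (k : Fin 4) :
    ContDiffOn ℝ ∞ (gradComp G u k) U :=
  ContDiffOn.sum fun l _ => (hG.contDiffOn_inv k l).mul (contDiffOn_pd hG.isOpen hu l)

theorem inv_symm (hx : x ∈ U) (i j : Fin 4) : (G x)⁻¹ i j = (G x)⁻¹ j i := by
  have h : (G x).transpose = G x := by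
    ext i j
    exact hG.symm x hx j i
  have := Matrix.transpose_nonsing_inv (G x)
  rw [h] at this
  exact congrFun (congrFun this.symm i) j

theorem sum_inv_mul (hx : x ∈ U) (k i : Fin 4) :
    ∑ l, (G x)⁻¹ k l * G x i l = if k = i then 1 else 0 := by
  have h := congrFun (congrFun
    (Matrix.nonsing_inv_mul (G x) (isUnit_iff_ne_zero.2 (hG.det_ne_zero x hx))) k) i
  rw [Matrix.mul_apply, Matrix.one_apply] at h
  rw [← h]
  exact Finset.sum_congr rfl fun l _ => by rw [hG.symm x hx i l]

theorem sum_mul_gradComp (hx : x ∈ U) (u : E4 → ℝ) (i : Fin 4) :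
    ∑ k, G x i k * gradComp G u k x = pd i u x := by
  simp only [gradComp, Finset.mul_sum]
  rw [Finset.sum_comm]
  have : ∀ l, ∑ k, G x i k * ((G x)⁻¹ k l * pd l u x) = (if l = i then 1 else 0) * pd l u x := by
    intro l
    rw [← hG.sum_inv_mul hx l i, Finset.sum_mul]
    exact Finset.sum_congr rfl fun k _ => by rw [hG.inv_symm hx l k]; ring
  simp [this]

theorem christoffel_symm (hx : x ∈ U) (k i j : Fin 4) :
    christoffel G k i j x = christoffel G k j i x := by
  simp only [christoffel]
  congr 1
  refine Finset.sum_congr rfl fun l _ => ?_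
  rw [pd_congr hG.isOpen (fun y hy => hG.symm y hy i j) l hx]
  ring

theorem sum_mul_christoffel (hx : x ∈ U) (m i j : Fin 4) :
    ∑ k, G x m k * christoffel G k i j x = (1 / 2) * (pd j (fun y => G y i m) x
      + pd i (fun y => G y j m) x - pd m (fun y => G y i j) x) := by
  simp only [christoffel, Finset.mul_sum]
  rw [Finset.sum_comm]
  have : ∀ l, ∑ k, G x m k * ((1 / 2) * ((G x)⁻¹ k l * (pd j (fun y => G y i l) x
      + pd i (fun y => G y j l) x - pd l (fun y => G y i j) x)))
      = (if l = m then 1 else 0) * ((1 / 2) * (pd j (fun y => G y i l) x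
      + pd i (fun y => G y j l) x - pd l (fun y => G y i j) x)) := by
    intro l
    rw [← hG.sum_inv_mul hx l m, Finset.sum_mul]
    exact Finset.sum_congr rfl fun k _ => by rw [hG.inv_symm hx l k]; ring
  simp only [this, ite_mul, one_mul, zero_mul, Finset.sum_ite_eq', Finset.mem_univ, if_true]

/-- The Levi-Civita connection is compatible with the metric. -/
theorem pd_metric (hx : x ∈ U) (k i j : Fin 4) : pd k (fun y => G y i j) x
    = ∑ a, (G x j a * christoffel G a k i x + G x i a * christoffel G a k j x) := by
  rw [Finset.sum_add_distrib, hG.sum_mul_christoffel hx, hG.sum_mul_christoffel hx,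
    pd_congr hG.isOpen (fun y hy => hG.symm y hy k j) i hx,
    pd_congr hG.isOpen (fun y hy => hG.symm y hy k i) j hx,
    pd_congr hG.isOpen (fun y hy => hG.symm y hy j i) k hx]
  ring

/-- The Levi-Civita connection is compatible with the inverse metric. -/
theorem pd_inv (hx : x ∈ U) (k i j : Fin 4) : pd k (fun y => (G y)⁻¹ i j) x
    = -∑ a, (christoffel G i k a x * (G x)⁻¹ a j + christoffel G j k a x * (G x)⁻¹ i a) := by
  set P := (G x)⁻¹ with hP
  set Γ : Matrix (Fin 4) (Fin 4) ℝ := Matrix.of fun i a => christoffel G i k a x with hΓ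
  set dP : Matrix (Fin 4) (Fin 4) ℝ := Matrix.of fun i j => pd k (fun y => (G y)⁻¹ i j) x with hdP
  set dG : Matrix (Fin 4) (Fin 4) ℝ := Matrix.of fun i j => pd k (fun y => G y i j) x with hdG
  have hGP : G x * P = 1 :=
    Matrix.mul_nonsing_inv (G x) (isUnit_iff_ne_zero.2 (hG.det_ne_zero x hx))
  have hPG : P * G x = 1 :=
    Matrix.nonsing_inv_mul (G x) (isUnit_iff_ne_zero.2 (hG.det_ne_zero x hx))
  have h1 : dG = Γ.transpose * G x + G x * Γ := by
    ext i j
    simp only [hdG, Matrix.of_apply, hG.pd_metric hx, Finset.sum_add_distrib, Matrix.add_apply,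
      Matrix.mul_apply, hΓ, Matrix.transpose_apply]
    congr 1
    exact Finset.sum_congr rfl fun a _ => by rw [hG.symm x hx j a, mul_comm]
  have h2 : dP * G x + P * dG = 0 := by
    ext i j
    have hd : ∀ l, DifferentiableAt ℝ (fun y => (G y)⁻¹ i l) x := fun l =>
      differentiableAt_of_contDiffOn hG.isOpen (hG.contDiffOn_inv i l) hx
    have hd' : ∀ l, DifferentiableAt ℝ (fun y => G y j l) x := fun l =>
      differentiableAt_of_contDiffOn hG.isOpen (hG.smooth j l) hx
    have := pd_congr hG.isOpen (fun y hy => hG.sum_inv_mul hy i j) k hx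
    rw [pd_const, pd_sum_mul _ hd hd'] at this
    simp only [Matrix.add_apply, Matrix.mul_apply, ← Finset.sum_add_distrib, Matrix.zero_apply]
    rw [← this]
    refine Finset.sum_congr rfl fun l _ => ?_
    simp only [hdP, hdG, Matrix.of_apply]
    rw [hG.symm x hx j l, pd_congr hG.isOpen (fun y hy => hG.symm y hy j l) k hx]
  have h3 : dP = -(Γ * P + P * Γ.transpose) := by
    have h4 : dP * G x = -(P * dG) := eq_neg_of_add_eq_zero_left h2
    calc dP = dP * G x * P := by rw [mul_assoc, hGP, mul_one]
      _ = -(P * Γ.transpose * (G x * P) + (P * G x) * Γ * P) := by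
        rw [h4, h1]
        noncomm_ring
      _ = _ := by rw [hGP, hPG, mul_one, one_mul, add_comm]
  have := congrFun (congrFun h3 i) j
  simp only [hdP, hΓ, Matrix.of_apply, Matrix.neg_apply, Matrix.add_apply, Matrix.mul_apply,
    Matrix.transpose_apply, ← Finset.sum_add_distrib] at this
  rw [this]
  exact congrArg _ (Finset.sum_congr rfl fun a _ => by ring)

theorem hess_symm (hu : ContDiffOn ℝ ∞ u U) (hx : x ∈ U) (i j : Fin 4) :
    hess G u i j x = hess G u j i x := by
  simp only [hess, hG.christoffel_symm hx _ i j,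
    pd_pd_comm (hu.contDiffAt (hG.isOpen.mem_nhds hx)) i j]

/-- The divergence of the gradient of `u` is the trace of its Hessian. -/
theorem sum_pd_gradComp (hu : ContDiffOn ℝ ∞ u U) (hx : x ∈ U) :
    ∑ k, (pd k (gradComp G u k) x + gradComp G u k x * ∑ a, christoffel G a a k x)
      = -laplacian G u x := by
  have hP := fun k l => differentiableAt_of_contDiffOn hG.isOpen (hG.contDiffOn_inv k l) hx
  have hd := fun l => differentiableAt_of_contDiffOn hG.isOpen (contDiffOn_pd hG.isOpen hu l) hx
  have h1 : ∀ k, pd k (gradComp G u k) x = ∑ l,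
      (pd k (fun y => (G y)⁻¹ k l) x * pd l u x + (G x)⁻¹ k l * pd k (pd l u) x) := by
    exact fun k => pd_sum_mul _ (hP k) hd k
  have h2 : ∑ k, ∑ l, (∑ a, christoffel G k k a x * (G x)⁻¹ a l) * pd l u x
      = ∑ k, gradComp G u k x * ∑ a, christoffel G a a k x := by
    have : ∀ k, ∑ l, (∑ a, christoffel G k k a x * (G x)⁻¹ a l) * pd l u x
        = ∑ a, gradComp G u a x * christoffel G k k a x := by
      intro k
      simp only [gradComp, Finset.sum_mul]
      rw [Finset.sum_comm]
      exact Finset.sum_congr rfl fun a _ => Finset.sum_congr rfl fun l _ => by ring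
    simp only [this, Finset.mul_sum]
    exact Finset.sum_comm
  have h3 : ∑ k, ∑ l, (∑ a, christoffel G l k a x * (G x)⁻¹ k a) * pd l u x
      = ∑ k, ∑ a, (G x)⁻¹ k a * ∑ l, christoffel G l k a x * pd l u x := by
    simp only [Finset.sum_mul, Finset.mul_sum]
    refine Finset.sum_congr rfl fun k _ => ?_
    rw [Finset.sum_comm]
    exact Finset.sum_congr rfl fun a _ => Finset.sum_congr rfl fun l _ => by ring
  simp only [laplacian, hess, neg_neg, Finset.sum_add_distrib, h1, hG.pd_inv hx, mul_sub,
    Finset.sum_sub_distrib, neg_mul, Finset.sum_neg_distrib, add_mul] at h2 h3 ⊢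
  linarith

end

end IsMetricOn

end Metric

/-! ### The change of the connection under a conformal change of the metric -/

/-- The difference `δᵏᵢ uⱼ + δᵏⱼ uᵢ - gᵢⱼ Uᵏ` of the Levi-Civita connections of `e²ᵘ g` and `g`, in
terms of the components `G` of `g`, `du` of the differential and `U` of the gradient of `u`. -/
def conformalShift (G : Matrix (Fin 4) (Fin 4) ℝ) (du U : Fin 4 → ℝ) (k i j : Fin 4) : ℝ :=
  (if k = i then du j else 0) + (if k = j then du i else 0) - G i j * U k

section Algebra

variable {G : Matrix (Fin 4) (Fin 4) ℝ} {du U : Fin 4 → ℝ}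

theorem sum_conformalShift_mul (X : Fin 4 → ℝ) (j l : Fin 4) :
    ∑ a, conformalShift G du U a j l * X a
      = X j * du l + X l * du j - G j l * ∑ a, U a * X a := by
  simp only [conformalShift, sub_mul, add_mul, ite_mul, zero_mul, Finset.sum_sub_distrib,
    Finset.sum_add_distrib, Finset.sum_ite_eq', Finset.mem_univ, if_true, Finset.mul_sum, mul_assoc]
  ring

/-- The double contraction that occurs in the second quadratic term `Γᵃₖₗ Γᵏⱼₐ` of the Ricci
tensor. -/
theorem sum_sum_mul_conformalShift (Y : Fin 4 → Fin 4 → ℝ) (j : Fin 4) :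
    ∑ k, ∑ a, Y k a * conformalShift G du U k j a
      = ∑ a, Y j a * du a + du j * ∑ k, Y k k - ∑ k, U k * ∑ a, Y k a * G j a := by
  have h1 : ∀ k, ∑ a, Y k a * conformalShift G du U k j a
      = (if k = j then ∑ a, Y k a * du a else 0) + du j * Y k k - U k * ∑ a, Y k a * G j a := by
    intro k
    simp only [conformalShift, mul_sub, mul_add, mul_ite, mul_zero, Finset.sum_sub_distrib,
      Finset.sum_add_distrib, Finset.sum_ite_eq, Finset.mem_univ, if_true, Finset.mul_sum]
    congr 1
    · congr 1
      · split_ifs <;> simp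
      · ring
    · exact Finset.sum_congr rfl fun a _ => by ring
  simp only [h1, Finset.sum_sub_distrib, Finset.sum_add_distrib, Finset.sum_ite_eq',
    Finset.mem_univ, if_true, Finset.mul_sum]

variable (hG : ∀ i j, G i j = G j i) (hU : ∀ i, ∑ k, G i k * U k = du i)

include hG

theorem conformalShift_symm (k i j : Fin 4) :
    conformalShift G du U k i j = conformalShift G du U k j i := by
  simp only [conformalShift, hG i j]
  ring

include hU

theorem sum_conformalShift_trace (l : Fin 4) : ∑ k, conformalShift G du U k k l = 4 * du l := by
  simp only [conformalShift, if_true, Finset.sum_sub_distrib, Finset.sum_add_distrib,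
    Finset.sum_ite_eq', Finset.mem_univ, hG _ l, hU]
  simp

/-- The change of the quadratic part of the Ricci tensor. -/
theorem sum_sum_add_conformalShift {Γ : Fin 4 → Fin 4 → Fin 4 → ℝ}
    (hΓ : ∀ k i j, Γ k i j = Γ k j i) (j l : Fin 4) :
    ∑ k, ∑ a, ((Γ a j l + conformalShift G du U a j l) * (Γ k k a + conformalShift G du U k k a)
        - (Γ a k l + conformalShift G du U a k l) * (Γ k j a + conformalShift G du U k j a))
      = ∑ k, ∑ a, (Γ a j l * Γ k k a - Γ a k l * Γ k j a) + 2 * ∑ a, Γ a j l * du a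
        - G j l * ∑ a, U a * ∑ k, Γ k k a + ∑ k, U k * ∑ a, (G l a * Γ a k j + G j a * Γ a k l)
        + 2 * du j * du l - 2 * G j l * ∑ a, U a * du a := by
  set T := conformalShift G du U with hT
  have t1 : ∑ k, ∑ a, Γ a j l * T k k a = 4 * ∑ a, Γ a j l * du a := by
    rw [Finset.sum_comm, Finset.mul_sum]
    refine Finset.sum_congr rfl fun a _ => ?_
    rw [← Finset.mul_sum, sum_conformalShift_trace hG hU]
    ring
  have t2 : ∑ k, ∑ a, T a j l * Γ k k a = (∑ k, Γ k k j) * du l + (∑ k, Γ k k l) * du j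
      - G j l * ∑ a, U a * ∑ k, Γ k k a := by
    rw [Finset.sum_comm, ← sum_conformalShift_mul (fun a => ∑ k, Γ k k a)]
    exact Finset.sum_congr rfl fun a _ => (Finset.mul_sum _ _ _).symm
  have t3 : ∑ k, ∑ a, T a j l * T k k a = 4 * (2 * du j * du l - G j l * ∑ a, U a * du a) := by
    have : ∑ k, ∑ a, T a j l * T k k a = 4 * ∑ a, T a j l * du a := by
      rw [Finset.sum_comm, Finset.mul_sum]
      refine Finset.sum_congr rfl fun a _ => ?_
      rw [← Finset.mul_sum, sum_conformalShift_trace hG hU]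
      ring
    rw [this, sum_conformalShift_mul]
    ring
  have t4 : ∑ k, ∑ a, Γ a k l * T k j a = ∑ a, Γ a j l * du a + du j * ∑ k, Γ k k l
      - ∑ k, U k * ∑ a, G j a * Γ a k l := by
    rw [sum_sum_mul_conformalShift (fun k a => Γ a k l)]
    simp only [mul_comm (G j _)]
  have t5 : ∑ k, ∑ a, T a k l * Γ k j a = ∑ a, Γ a j l * du a + du l * ∑ k, Γ k k j
      - ∑ k, U k * ∑ a, G l a * Γ a k j := by
    have : ∑ k, ∑ a, T a k l * Γ k j a = ∑ a, ∑ k, Γ k j a * T a l k := by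
      rw [Finset.sum_comm]
      exact Finset.sum_congr rfl fun a _ => Finset.sum_congr rfl fun k _ => by
        rw [hT, conformalShift_symm hG]
        ring
    rw [this, sum_sum_mul_conformalShift (fun a k => Γ k j a)]
    simp only [hΓ _ j, mul_comm (G l _)]
  have t6 : ∑ k, ∑ a, T a k l * T k j a = 6 * du j * du l - 2 * G j l * ∑ a, U a * du a := by
    have h1 : ∀ k, ∑ a, T a k l * G j a = G j k * du l + G j l * du k - G k l * du j := by
      intro k
      rw [sum_conformalShift_mul, ← hU j]
      simp only [mul_comm]
    have h2 : ∑ k, U k * (G j k * du l + G j l * du k - G k l * du j)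
        = G j l * ∑ a, U a * du a := by
      have : ∀ k, U k * (G j k * du l + G j l * du k - G k l * du j)
          = du l * (G j k * U k) + G j l * (U k * du k) - du j * (G l k * U k) := by
        intro k
        rw [hG k l]
        ring
      simp only [this, Finset.sum_sub_distrib, Finset.sum_add_distrib, ← Finset.mul_sum, hU]
      ring
    rw [sum_sum_mul_conformalShift (fun k a => T a k l), sum_conformalShift_mul,
      sum_conformalShift_trace hG hU]
    simp only [h1, h2]
    ring
  have expand : ∀ k a,
      (Γ a j l + T a j l) * (Γ k k a + T k k a) - (Γ a k l + T a k l) * (Γ k j a + T k j a)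
      = (Γ a j l * Γ k k a - Γ a k l * Γ k j a) + Γ a j l * T k k a + T a j l * Γ k k a
        + T a j l * T k k a - Γ a k l * T k j a - T a k l * Γ k j a - T a k l * T k j a := by
    intro k a
    ring
  have split : ∑ k, U k * ∑ a, (G l a * Γ a k j + G j a * Γ a k l)
      = ∑ k, U k * ∑ a, G l a * Γ a k j + ∑ k, U k * ∑ a, G j a * Γ a k l := by
    simp only [Finset.sum_add_distrib, mul_add]
  simp only [expand]
  rw [split]
  simp only [Finset.sum_add_distrib, Finset.sum_sub_distrib, t1, t2, t3, t4, t5, t6]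
  ring

end Algebra

/-- The components of the conformal metric `e²ᵘ g`. -/
def conformal (u : E4 → ℝ) (G : E4 → Matrix (Fin 4) (Fin 4) ℝ) (y : E4) :
    Matrix (Fin 4) (Fin 4) ℝ :=
  Real.exp (2 * u y) • G y

/-- The components of the Ricci tensor, whose trace is the scalar curvature. -/
def ricci (G : E4 → Matrix (Fin 4) (Fin 4) ℝ) (j l : Fin 4) (x : E4) : ℝ :=
  ∑ k, (pd k (christoffel G k j l) x - pd j (christoffel G k k l) x
      + ∑ a, (christoffel G a j l x * christoffel G k k a x
        - christoffel G a k l x * christoffel G k j a x))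

theorem scalarCurv_eq_sum_ricci (G : E4 → Matrix (Fin 4) (Fin 4) ℝ) (x : E4) :
    scalarCurv G x = ∑ j, ∑ l, (G x)⁻¹ j l * ricci G j l x := rfl

section Conformal

variable {U : Set E4} {G : E4 → Matrix (Fin 4) (Fin 4) ℝ} {u v w : E4 → ℝ} {x : E4}

theorem conformal_inv (u : E4 → ℝ) (h : (G x).det ≠ 0) :
    (conformal u G x)⁻¹ = Real.exp (-(2 * u x)) • (G x)⁻¹ := by
  refine Matrix.inv_eq_left_inv ?_
  rw [conformal, Matrix.smul_mul, Matrix.mul_smul, smul_smul, ← Real.exp_add,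
    Matrix.nonsing_inv_mul _ (isUnit_iff_ne_zero.2 h)]
  simp

namespace IsMetricOn

variable (hG : IsMetricOn U G) (hu : ContDiffOn ℝ ∞ u U)

include hG hu

theorem pd_conformal (hx : x ∈ U) (k i j : Fin 4) : pd k (fun y => conformal u G y i j) x
    = Real.exp (2 * u x) * (2 * pd k u x * G x i j + pd k (fun y => G y i j) x) := by
  have hd := differentiableAt_of_contDiffOn hG.isOpen hu hx
  have hd' := differentiableAt_of_contDiffOn hG.isOpen (hG.smooth i j) hx
  simp only [conformal, Matrix.smul_apply, smul_eq_mul]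
  rw [pd_mul (hd.const_mul 2).exp hd', pd_exp (hd.const_mul 2), pd_const_mul hd]
  ring

theorem christoffel_conformal (hx : x ∈ U) (k i j : Fin 4) :
    christoffel (conformal u G) k i j x = christoffel G k i j x
      + conformalShift (G x) (fun m => pd m u x) (fun m => gradComp G u m x) k i j := by
  have he : Real.exp (-(2 * u x)) * Real.exp (2 * u x) = 1 := by
    rw [← Real.exp_add]
    simp
  have h : ∀ l, (conformal u G x)⁻¹ k l * (pd j (fun y => conformal u G y i l) x
      + pd i (fun y => conformal u G y j l) x - pd l (fun y => conformal u G y i j) x)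
      = (G x)⁻¹ k l * (pd j (fun y => G y i l) x + pd i (fun y => G y j l) x
          - pd l (fun y => G y i j) x)
        + 2 * (pd j u x * ((G x)⁻¹ k l * G x i l) + pd i u x * ((G x)⁻¹ k l * G x j l)
          - G x i j * ((G x)⁻¹ k l * pd l u x)) := by
    intro l
    simp only [hG.pd_conformal hu hx, conformal_inv u (hG.det_ne_zero x hx), Matrix.smul_apply,
      smul_eq_mul]
    linear_combination (G x)⁻¹ k l * (2 * pd j u x * G x i l + pd j (fun y => G y i l) x
      + (2 * pd i u x * G x j l + pd i (fun y => G y j l) x)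
      - (2 * pd l u x * G x i j + pd l (fun y => G y i j) x)) * he
  simp only [christoffel, h, Finset.sum_add_distrib, ← Finset.mul_sum, Finset.sum_sub_distrib,
    hG.sum_inv_mul hx, conformalShift, gradComp, mul_ite, mul_one, mul_zero]
  ring

/-- The terms of `ricci` that are linear in the change of the connection combine, by metric
compatibility, into the Hessian of `u` and the divergence of its gradient, which is `-Δu`. -/
theorem ricci_conformal (hx : x ∈ U) (j l : Fin 4) : ricci (conformal u G) j l x
    = ricci G j l x - 2 * hess G u j l x + 2 * pd j u x * pd l u x
      + G x j l * (laplacian G u x - 2 * dInner G u u x) := by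
  have hdu := fun l => differentiableAt_of_contDiffOn hG.isOpen (contDiffOn_pd hG.isOpen hu l) hx
  have hdU := fun k => differentiableAt_of_contDiffOn hG.isOpen (hG.contDiffOn_gradComp hu k) hx
  have hdΓ := fun k i j =>
    differentiableAt_of_contDiffOn hG.isOpen (hG.contDiffOn_christoffel k i j) hx
  have hdG := fun i j => differentiableAt_of_contDiffOn hG.isOpen (hG.smooth i j) hx
  have hite : ∀ (p : Prop) [Decidable p] (m : Fin 4),
      DifferentiableAt ℝ (fun y => if p then pd m u y else 0) x := by
    intro p _ m
    split_ifs
    · exact hdu m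
    · exact differentiableAt_const _
  have pd_ite : ∀ (p : Prop) [Decidable p] (k m : Fin 4),
      pd k (fun y => if p then pd m u y else 0) x = if p then pd k (pd m u) x else 0 := by
    intro p _ k m
    split_ifs
    · rfl
    · exact pd_const _ _ _
  have hdT : ∀ k i j, DifferentiableAt ℝ (fun y => conformalShift (G y) (fun m => pd m u y)
      (fun m => gradComp G u m y) k i j) x := fun k i j =>
    ((hite _ _).add (hite _ _)).sub ((hdG i j).mul (hdU k))
  have hpdT : ∀ m k i j, pd m (fun y => conformalShift (G y) (fun m => pd m u y)
      (fun m => gradComp G u m y) k i j) x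
      = (if k = i then pd m (pd j u) x else 0) + (if k = j then pd m (pd i u) x else 0)
        - (pd m (fun y => G y i j) x * gradComp G u k x + G x i j * pd m (gradComp G u k) x) := by
    intro m k i j
    simp only [conformalShift]
    rw [pd_sub ((hite _ _).fun_add (hite _ _)) ((hdG i j).fun_mul (hdU k)),
      pd_add (hite _ _) (hite _ _), pd_mul (hdG i j) (hdU k), pd_ite, pd_ite]
  have hpdΓ : ∀ m k i j, pd m (christoffel (conformal u G) k i j) x
      = pd m (christoffel G k i j) x + pd m (fun y => conformalShift (G y) (fun m => pd m u y)
        (fun m => gradComp G u m y) k i j) x := by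
    intro m k i j
    rw [pd_congr hG.isOpen (fun y hy => hG.christoffel_conformal hu hy k i j) m hx,
      pd_add (hdΓ k i j) (hdT k i j)]
  have htr : ∑ k, pd j (fun y => conformalShift (G y) (fun m => pd m u y)
      (fun m => gradComp G u m y) k k l) x = 4 * pd j (pd l u) x := by
    rw [← pd_sum _ (fun k _ => hdT k k l), pd_congr hG.isOpen (fun y hy =>
      sum_conformalShift_trace (hG.symm y hy) (hG.sum_mul_gradComp hy u) l) j hx,
      pd_const_mul (hdu l)]
  have hdG' : ∑ k, pd k (fun y => G y j l) x * gradComp G u k x = ∑ k, gradComp G u k x *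
      ∑ a, (G x l a * christoffel G a k j x + G x j a * christoffel G a k l x) :=
    Finset.sum_congr rfl fun k _ => by rw [hG.pd_metric hx, mul_comm]
  have hdiv := hG.sum_pd_gradComp hu hx
  have hn : dInner G u u x = ∑ a, gradComp G u a x * pd a u x := by
    simp only [dInner_eq_sum_gradComp, mul_comm]
  have hquad := sum_sum_add_conformalShift (hG.symm x hx) (hG.sum_mul_gradComp hx u)
    (fun k i j => hG.christoffel_symm hx k i j) j l
  have hc := pd_pd_comm (hu.contDiffAt (hG.isOpen.mem_nhds hx)) l j
  simp only [ricci, Finset.sum_add_distrib, Finset.sum_sub_distrib] at hquad hdiv ⊢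
  simp only [hpdΓ, hG.christoffel_conformal hu hx, Finset.sum_add_distrib, htr]
  simp only [hpdT, Finset.sum_add_distrib, Finset.sum_sub_distrib, Finset.sum_ite_eq',
    Finset.mem_univ, if_true, ← Finset.mul_sum, hess, hn] at hquad hdG' hdiv ⊢
  linear_combination hquad - hdG' - G x j l * hdiv + hc

end IsMetricOn

end Conformal

/-! ### Contractions with the inverse metric -/

section Contractions

variable {P G : Matrix (Fin 4) (Fin 4) ℝ}

/-- The pairing `gᵇᵖ gˡᵠ A_{bl} B_{pq}` of covariant two-tensors. -/
def contract (P : Matrix (Fin 4) (Fin 4) ℝ) (A B : Fin 4 → Fin 4 → ℝ) : ℝ :=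
  ∑ b, ∑ l, ∑ p, ∑ q, P b p * P l q * A b l * B p q

theorem contract_comm (hP : ∀ i j, P i j = P j i) (A B : Fin 4 → Fin 4 → ℝ) :
    contract P A B = contract P B A := by
  have h : ∀ C : Fin 4 → Fin 4 → Fin 4 → Fin 4 → ℝ,
      ∑ b, ∑ l, ∑ p, ∑ q, C b l p q = ∑ p, ∑ q, ∑ b, ∑ l, C b l p q := by
    intro C
    calc ∑ b, ∑ l, ∑ p, ∑ q, C b l p q = ∑ b, ∑ p, ∑ q, ∑ l, C b l p q :=
          Finset.sum_congr rfl fun b _ => by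
            rw [Finset.sum_comm]
            exact Finset.sum_congr rfl fun p _ => Finset.sum_comm
      _ = _ := by
            rw [Finset.sum_comm]
            exact Finset.sum_congr rfl fun p _ => Finset.sum_comm
  rw [contract, h]
  refine Finset.sum_congr rfl fun p _ => Finset.sum_congr rfl fun q _ =>
    Finset.sum_congr rfl fun b _ => Finset.sum_congr rfl fun l _ => ?_
  rw [hP p b, hP q l]
  ring

/-- Pairing with a conformal correction `x ⊗ y + y ⊗ x - c g`. -/
theorem contract_sub (hPG : ∀ k i, ∑ l, P k l * G i l = if k = i then 1 else 0)
    (A B : Fin 4 → Fin 4 → ℝ) (x y : Fin 4 → ℝ) (c : ℝ) :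
    contract P A (fun p q => B p q - (x p * y q + x q * y p - c * G p q))
      = contract P A B
        - (∑ b, ∑ l, A b l * (∑ p, P b p * x p) * (∑ q, P l q * y q)
          + ∑ b, ∑ l, A b l * (∑ p, P b p * y p) * (∑ q, P l q * x q))
        + c * ∑ b, ∑ l, P b l * A b l := by
  have h1 : ∀ b l, ∀ z t : Fin 4 → ℝ, ∑ p, ∑ q, P b p * P l q * A b l * (z p * t q)
      = A b l * (∑ p, P b p * z p) * (∑ q, P l q * t q) := by
    intro b l z t
    rw [mul_assoc, Finset.sum_mul_sum, Finset.mul_sum]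
    refine Finset.sum_congr rfl fun p _ => ?_
    rw [Finset.mul_sum]
    exact Finset.sum_congr rfl fun q _ => by ring
  have h2 : ∀ b l, ∑ p, ∑ q, P b p * P l q * A b l * (c * G p q) = c * (P b l * A b l) := by
    intro b l
    have : ∀ p, ∑ q, P b p * P l q * A b l * (c * G p q)
        = c * P b p * A b l * (if l = p then 1 else 0) := by
      intro p
      rw [← hPG l p, Finset.mul_sum]
      exact Finset.sum_congr rfl fun q _ => by ring
    simp only [this, mul_ite, mul_one, mul_zero, Finset.sum_ite_eq, Finset.mem_univ, if_true]
    ring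
  have h3 : ∀ p q, B p q - (x p * y q + x q * y p - c * G p q)
      = B p q - (x p * y q + y p * x q) + c * G p q := fun p q => by ring
  simp only [contract, h3]
  simp only [mul_add, mul_sub, Finset.sum_add_distrib, Finset.sum_sub_distrib, h1, h2,
    ← Finset.mul_sum]

end Contractions

/-- The value `(∇df)(∇u, ∇v)` of the Hessian of `f`. -/
def hessGrad (G : E4 → Matrix (Fin 4) (Fin 4) ℝ) (f u v : E4 → ℝ) (x : E4) : ℝ :=
  ∑ b, ∑ l, hess G f b l x * gradComp G u b x * gradComp G v l x

/-! ### The Laplacian of products and exponentials -/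

section Laplacian

variable {U : Set E4} {G : E4 → Matrix (Fin 4) (Fin 4) ℝ} {f h u v : E4 → ℝ} {x : E4}

theorem laplacian_congr (hU : IsOpen U) (huv : Set.EqOn u v U) (hx : x ∈ U) :
    laplacian G u x = laplacian G v x := by
  simp only [laplacian, hess, pd_congr hU huv _ hx,
    fun i j => pd_congr hU (pd_congr hU huv j) i hx]

theorem contDiffOn_exp_neg (hu : ContDiffOn ℝ ∞ u U) :
    ContDiffOn ℝ ∞ (fun y => Real.exp (-(2 * u y))) U :=
  (contDiffOn_const.mul hu).neg.exp

namespace IsMetricOn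

variable (hG : IsMetricOn U G)

include hG

theorem dInner_comm (hx : x ∈ U) (u v : E4 → ℝ) : dInner G u v x = dInner G v u x := by
  simp only [dInner]
  rw [Finset.sum_comm]
  exact Finset.sum_congr rfl fun l _ => Finset.sum_congr rfl fun j _ => by
    rw [hG.inv_symm hx l j]
    ring

theorem sum_gradComp_mul (hx : x ∈ U) (u v : E4 → ℝ) :
    ∑ k, gradComp G u k x * pd k v x = dInner G u v x := by
  rw [hG.dInner_comm hx, dInner_eq_sum_gradComp]
  simp only [mul_comm]

theorem sum_inv_mul_metric (hx : x ∈ U) : ∑ i, ∑ j, (G x)⁻¹ i j * G x i j = 4 := by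
  simp [hG.sum_inv_mul hx]

theorem hess_mul (hu : ContDiffOn ℝ ∞ u U) (hv : ContDiffOn ℝ ∞ v U) (hx : x ∈ U) (i j : Fin 4) :
    hess G (fun y => u y * v y) i j x = u x * hess G v i j x + v x * hess G u i j x
      + (pd i u x * pd j v x + pd j u x * pd i v x) := by
  have hd := fun y (hy : y ∈ U) => differentiableAt_of_contDiffOn hG.isOpen hu hy
  have hd' := fun y (hy : y ∈ U) => differentiableAt_of_contDiffOn hG.isOpen hv hy
  have hdu := differentiableAt_of_contDiffOn hG.isOpen (contDiffOn_pd hG.isOpen hu j) hx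
  have hdv := differentiableAt_of_contDiffOn hG.isOpen (contDiffOn_pd hG.isOpen hv j) hx
  have h1 := fun k => pd_mul (hd x hx) (hd' x hx) k
  have h2 := pd_congr hG.isOpen (fun y hy => pd_mul (hd y hy) (hd' y hy) j) i hx
  rw [pd_add (hdu.fun_mul (hd' x hx)) ((hd x hx).fun_mul hdv), pd_mul hdu (hd' x hx),
    pd_mul (hd x hx) hdv] at h2
  simp only [hess, h1, h2, mul_add, Finset.sum_add_distrib, mul_sub, Finset.mul_sum]
  simp only [mul_comm, mul_left_comm]
  ring

theorem laplacian_mul (hu : ContDiffOn ℝ ∞ u U) (hv : ContDiffOn ℝ ∞ v U) (hx : x ∈ U) :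
    laplacian G (fun y => u y * v y) x
      = u x * laplacian G v x + v x * laplacian G u x - 2 * dInner G u v x := by
  have h : ∀ i j, (G x)⁻¹ i j * hess G (fun y => u y * v y) i j x
      = u x * ((G x)⁻¹ i j * hess G v i j x) + v x * ((G x)⁻¹ i j * hess G u i j x)
        + ((G x)⁻¹ i j * pd i u x * pd j v x + (G x)⁻¹ i j * pd i v x * pd j u x) := by
    intro i j
    rw [hG.hess_mul hu hv hx]
    ring
  have hc := hG.dInner_comm hx v u
  simp only [laplacian, h, Finset.sum_add_distrib, ← Finset.mul_sum]
  simp only [dInner] at hc ⊢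
  linear_combination -hc

theorem pd_exp_neg (hu : ContDiffOn ℝ ∞ u U) (hx : x ∈ U) (i : Fin 4) :
    pd i (fun y => Real.exp (-(2 * u y))) x = -2 * (Real.exp (-(2 * u x)) * pd i u x) := by
  have hd := differentiableAt_of_contDiffOn hG.isOpen hu hx
  have : (fun y => Real.exp (-(2 * u y))) = fun y => Real.exp (-2 * u y) := by
    ext y
    ring_nf
  rw [this, pd_exp (hd.const_mul _), pd_const_mul hd]
  ring_nf

theorem dInner_exp_neg (hu : ContDiffOn ℝ ∞ u U) (v : E4 → ℝ) (hx : x ∈ U) :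
    dInner G (fun y => Real.exp (-(2 * u y))) v x
      = -2 * Real.exp (-(2 * u x)) * dInner G u v x := by
  simp only [dInner, hG.pd_exp_neg hu hx, Finset.mul_sum]
  exact Finset.sum_congr rfl fun i _ => Finset.sum_congr rfl fun j _ => by ring

theorem laplacian_exp_neg (hu : ContDiffOn ℝ ∞ u U) (hx : x ∈ U) :
    laplacian G (fun y => Real.exp (-(2 * u y))) x
      = -2 * Real.exp (-(2 * u x)) * (laplacian G u x + 2 * dInner G u u x) := by
  have hs := contDiffOn_exp_neg hu
  have hds := differentiableAt_of_contDiffOn hG.isOpen hs hx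
  have h : ∀ i j, (G x)⁻¹ i j * hess G (fun y => Real.exp (-(2 * u y))) i j x
      = -2 * Real.exp (-(2 * u x)) * ((G x)⁻¹ i j * hess G u i j x)
        + 4 * Real.exp (-(2 * u x)) * ((G x)⁻¹ i j * pd i u x * pd j u x) := by
    intro i j
    have hdu := differentiableAt_of_contDiffOn hG.isOpen (contDiffOn_pd hG.isOpen hu j) hx
    have h2 := pd_congr hG.isOpen (fun y hy => hG.pd_exp_neg hu hy j) i hx
    rw [pd_const_mul (hds.fun_mul hdu), pd_mul hds hdu, hG.pd_exp_neg hu hx] at h2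
    have h3 : ∀ k, christoffel G k i j x * (-2 * (Real.exp (-(2 * u x)) * pd k u x))
        = -2 * Real.exp (-(2 * u x)) * (christoffel G k i j x * pd k u x) := fun k => by ring
    simp only [hess, h2, hG.pd_exp_neg hu hx, h3, ← Finset.mul_sum]
    ring
  simp only [laplacian, h, Finset.sum_add_distrib, ← Finset.mul_sum, dInner]
  ring

theorem pd_dInner (hf : ContDiffOn ℝ ∞ f U) (hh : ContDiffOn ℝ ∞ h U) (hx : x ∈ U) (k : Fin 4) :
    pd k (dInner G f h) x
      = ∑ j, hess G f k j x * gradComp G h j x + ∑ l, hess G h k l x * gradComp G f l x := by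
  have hP := fun k l => differentiableAt_of_contDiffOn hG.isOpen (hG.contDiffOn_inv k l) hx
  have hdf := fun l => differentiableAt_of_contDiffOn hG.isOpen (contDiffOn_pd hG.isOpen hf l) hx
  have hdh := fun l => differentiableAt_of_contDiffOn hG.isOpen (contDiffOn_pd hG.isOpen hh l) hx
  have hdgrad := fun l =>
    differentiableAt_of_contDiffOn hG.isOpen (hG.contDiffOn_gradComp hh l) hx
  have h1 : pd k (dInner G f h) x
      = ∑ j, (pd k (pd j f) x * gradComp G h j x + pd j f x * pd k (gradComp G h j) x) := by
    rw [funext (dInner_eq_sum_gradComp G f h), pd_sum_mul _ hdf hdgrad]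
  have h2 : ∀ j, pd k (gradComp G h j) x = ∑ l, (G x)⁻¹ j l * hess G h k l x
      - ∑ a, christoffel G j k a x * gradComp G h a x := by
    intro j
    have e1 : pd k (gradComp G h j) x = ∑ l,
        (pd k (fun y => (G y)⁻¹ j l) x * pd l h x + (G x)⁻¹ j l * pd k (pd l h) x) :=
      pd_sum_mul _ (hP j) hdh k
    have e2 : ∑ l, (∑ a, christoffel G j k a x * (G x)⁻¹ a l) * pd l h x
        = ∑ a, christoffel G j k a x * gradComp G h a x := by
      simp only [gradComp, Finset.sum_mul, Finset.mul_sum]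
      rw [Finset.sum_comm]
      exact Finset.sum_congr rfl fun a _ => Finset.sum_congr rfl fun l _ => by ring
    have e3 : ∑ l, (∑ a, christoffel G l k a x * (G x)⁻¹ j a) * pd l h x
        = ∑ a, (G x)⁻¹ j a * ∑ l, christoffel G l k a x * pd l h x := by
      simp only [Finset.sum_mul, Finset.mul_sum]
      rw [Finset.sum_comm]
      exact Finset.sum_congr rfl fun a _ => Finset.sum_congr rfl fun l _ => by ring
    simp only [e1, hG.pd_inv hx, hess, mul_sub, neg_mul, add_mul, Finset.sum_add_distrib,
      Finset.sum_sub_distrib, Finset.sum_neg_distrib] at e2 e3 ⊢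
    linarith
  have h3 : ∑ j, pd j f x * ∑ l, (G x)⁻¹ j l * hess G h k l x
      = ∑ l, hess G h k l x * gradComp G f l x := by
    simp only [gradComp, Finset.mul_sum]
    rw [Finset.sum_comm]
    exact Finset.sum_congr rfl fun l _ => Finset.sum_congr rfl fun j _ => by
      rw [hG.inv_symm hx l j]
      ring
  have h4 : ∑ j, pd j f x * ∑ a, christoffel G j k a x * gradComp G h a x
      = ∑ a, (∑ j, christoffel G j k a x * pd j f x) * gradComp G h a x := by
    simp only [Finset.mul_sum, Finset.sum_mul]
    rw [Finset.sum_comm]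
    exact Finset.sum_congr rfl fun l _ => Finset.sum_congr rfl fun j _ => by ring
  rw [← h3, h1]
  simp only [h2, hess, mul_sub, sub_mul, Finset.sum_add_distrib, Finset.sum_sub_distrib] at h4 ⊢
  linarith

/-- Leibniz rule for `⟨∇u, ∇⟨∇f, ∇h⟩⟩`. -/
theorem dInner_dInner (hf : ContDiffOn ℝ ∞ f U) (hh : ContDiffOn ℝ ∞ h U) (hx : x ∈ U)
    (u : E4 → ℝ) :
    dInner G u (dInner G f h) x = hessGrad G f u h x + hessGrad G h u f x := by
  rw [← hG.sum_gradComp_mul hx]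
  simp only [hG.pd_dInner hf hh hx, mul_add, Finset.sum_add_distrib, hessGrad, Finset.mul_sum]
  congr 1 <;> exact Finset.sum_congr rfl fun l _ => Finset.sum_congr rfl fun j _ => by ring

theorem hessGrad_comm (hf : ContDiffOn ℝ ∞ f U) (hx : x ∈ U) (u v : E4 → ℝ) :
    hessGrad G f u v x = hessGrad G f v u x := by
  simp only [hessGrad]
  rw [Finset.sum_comm]
  exact Finset.sum_congr rfl fun l _ => Finset.sum_congr rfl fun j _ => by
    rw [hG.hess_symm hf hx l j]
    ring

end IsMetricOn

end Laplacian

/-! ### Conformal covariance of the density -/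

section Covariance

variable {U : Set E4} {G : E4 → Matrix (Fin 4) (Fin 4) ℝ} {f h u v : E4 → ℝ} {x : E4}

namespace IsMetricOn

theorem dInner_conformal (hG : IsMetricOn U G) (hx : x ∈ U) (u f h : E4 → ℝ) :
    dInner (conformal u G) f h x = Real.exp (-(2 * u x)) * dInner G f h x := by
  simp only [dInner, conformal_inv u (hG.det_ne_zero x hx), Matrix.smul_apply, smul_eq_mul,
    Finset.mul_sum, mul_assoc]

variable (hG : IsMetricOn U G) (hu : ContDiffOn ℝ ∞ u U)

include hG hu

theorem scalarCurv_conformal (hx : x ∈ U) : scalarCurv (conformal u G) x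
    = Real.exp (-(2 * u x)) * (scalarCurv G x + 6 * laplacian G u x - 6 * dInner G u u x) := by
  have key : ∀ j l, (conformal u G x)⁻¹ j l * ricci (conformal u G) j l x
      = Real.exp (-(2 * u x)) * ((G x)⁻¹ j l * ricci G j l x - 2 * ((G x)⁻¹ j l * hess G u j l x)
        + 2 * ((G x)⁻¹ j l * pd j u x * pd l u x)
        + (laplacian G u x - 2 * dInner G u u x) * ((G x)⁻¹ j l * G x j l)) := by
    intro j l
    rw [conformal_inv u (hG.det_ne_zero x hx), hG.ricci_conformal hu hx, Matrix.smul_apply,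
      smul_eq_mul]
    ring
  have h4 := hG.sum_inv_mul_metric hx
  simp only [scalarCurv_eq_sum_ricci, key, ← Finset.mul_sum, Finset.sum_add_distrib,
    Finset.sum_sub_distrib, h4]
  simp only [laplacian, dInner]
  ring

theorem hess_conformal (hx : x ∈ U) (v : E4 → ℝ) (i j : Fin 4) : hess (conformal u G) v i j x
    = hess G v i j x
      - (pd i u x * pd j v x + pd j u x * pd i v x - dInner G u v x * G x i j) := by
  have := sum_conformalShift_mul (G := G x) (du := fun m => pd m u x)
    (U := fun m => gradComp G u m x) (fun k => pd k v x) i j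
  rw [hG.sum_gradComp_mul hx] at this
  simp only [hess, hG.christoffel_conformal hu hx, add_mul, Finset.sum_add_distrib, this]
  ring

theorem laplacian_conformal (hx : x ∈ U) (v : E4 → ℝ) : laplacian (conformal u G) v x
    = Real.exp (-(2 * u x)) * (laplacian G v x - 2 * dInner G u v x) := by
  have key : ∀ i j, (conformal u G x)⁻¹ i j * hess (conformal u G) v i j x
      = Real.exp (-(2 * u x)) * ((G x)⁻¹ i j * hess G v i j x
        - ((G x)⁻¹ i j * pd i u x * pd j v x + (G x)⁻¹ i j * pd i v x * pd j u x)
        + dInner G u v x * ((G x)⁻¹ i j * G x i j)) := by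
    intro i j
    rw [conformal_inv u (hG.det_ne_zero x hx), hG.hess_conformal hu hx, Matrix.smul_apply,
      smul_eq_mul]
    ring
  have h4 := hG.sum_inv_mul_metric hx
  have hc := hG.dInner_comm hx v u
  simp only [laplacian, key, ← Finset.mul_sum, Finset.sum_add_distrib,
    Finset.sum_sub_distrib, h4]
  simp only [dInner] at hc ⊢
  linear_combination Real.exp (-(2 * u x)) * hc

/-- Both the Laplacian and the function `⟨df, dh⟩` it is applied to depend on the metric. -/
theorem laplacian_dInner_conformal (hf : ContDiffOn ℝ ∞ f U) (hh : ContDiffOn ℝ ∞ h U)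
    (hx : x ∈ U) : laplacian (conformal u G) (dInner (conformal u G) f h) x
    = Real.exp (-(2 * u x)) ^ 2 * (laplacian G (dInner G f h) x + 2 * dInner G u (dInner G f h) x
      - 2 * laplacian G u x * dInner G f h x) := by
  have hs := contDiffOn_exp_neg hu
  have hw := hG.contDiffOn_dInner hf hh
  have hds := differentiableAt_of_contDiffOn hG.isOpen hs hx
  have hdw := differentiableAt_of_contDiffOn hG.isOpen hw hx
  have h1 : dInner G u (fun y => Real.exp (-(2 * u y)) * dInner G f h y) x
      = Real.exp (-(2 * u x)) * (dInner G u (dInner G f h) x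
        - 2 * dInner G f h x * dInner G u u x) := by
    rw [← hG.sum_gradComp_mul hx, ← hG.sum_gradComp_mul hx u u, ← hG.sum_gradComp_mul hx u]
    simp only [pd_mul hds hdw, hG.pd_exp_neg hu hx, Finset.mul_sum, ← Finset.sum_sub_distrib]
    exact Finset.sum_congr rfl fun k _ => by ring
  rw [laplacian_congr hG.isOpen (fun y hy => hG.dInner_conformal hy u f h) hx,
    hG.laplacian_conformal hu hx, hG.laplacian_mul hs hw hx, hG.laplacian_exp_neg hu hx,
    hG.dInner_exp_neg hu _ hx, h1]
  ring

theorem hessInner_conformal (hf : ContDiffOn ℝ ∞ f U) (hh : ContDiffOn ℝ ∞ h U) (hx : x ∈ U) :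
    hessInner (conformal u G) f h x
    = Real.exp (-(2 * u x)) ^ 2 * (hessInner G f h x
      - 2 * (hessGrad G f u h x + hessGrad G h u f x)
      - dInner G u h x * laplacian G f x - dInner G u f x * laplacian G h x
      + 2 * dInner G u u x * dInner G f h x + 2 * dInner G u f x * dInner G u h x) := by
  have h0 : hessInner (conformal u G) f h x = Real.exp (-(2 * u x)) ^ 2 *
      contract (G x)⁻¹ (fun b l => hess (conformal u G) f b l x)
        (fun p q => hess G h p q x
          - (pd p u x * pd q h x + pd q u x * pd p h x - dInner G u h x * G x p q)) := by
    simp only [hessInner, contract, conformal_inv u (hG.det_ne_zero x hx), Matrix.smul_apply,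
      smul_eq_mul, Finset.mul_sum, hG.hess_conformal hu hx h]
    exact Finset.sum_congr rfl fun b _ => Finset.sum_congr rfl fun l _ =>
      Finset.sum_congr rfl fun p _ => Finset.sum_congr rfl fun q _ => by ring
  have h1 : contract (G x)⁻¹ (fun b l => hess (conformal u G) f b l x)
      (fun p q => hess G h p q x) = hessInner G f h x
        - (hessGrad G h u f x + hessGrad G h f u x) - dInner G u f x * laplacian G h x := by
    simp only [hG.hess_conformal hu hx f]
    rw [contract_comm (hG.inv_symm hx), contract_sub (hG.sum_inv_mul hx),
      contract_comm (hG.inv_symm hx)]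
    simp only [laplacian, hessGrad, gradComp, hessInner, contract]
    ring
  -- the corrected Hessian of `f` on a pair of gradients
  have h2 : ∀ a b : E4 → ℝ, ∑ i, ∑ j, hess (conformal u G) f i j x * gradComp G a i x
      * gradComp G b j x = hessGrad G f a b x - (dInner G a u x * dInner G b f x
        + dInner G b u x * dInner G a f x - dInner G u f x * dInner G a b x) := by
    intro a b
    have e1 : ∀ i, ∑ j, hess (conformal u G) f i j x * gradComp G a i x * gradComp G b j x
        = ∑ j, hess G f i j x * gradComp G a i x * gradComp G b j x
          - (gradComp G a i x * pd i u x * dInner G b f x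
            + dInner G b u x * (gradComp G a i x * pd i f x)
            - dInner G u f x * (gradComp G a i x * pd i b x)) := by
      intro i
      rw [← hG.sum_gradComp_mul hx b f, ← hG.sum_gradComp_mul hx b u, ← hG.sum_mul_gradComp hx b i]
      simp only [hG.hess_conformal hu hx, Finset.mul_sum, Finset.sum_mul,
        ← Finset.sum_sub_distrib, ← Finset.sum_add_distrib]
      exact Finset.sum_congr rfl fun j _ => by ring
    simp only [e1, Finset.sum_sub_distrib, Finset.sum_add_distrib, ← Finset.mul_sum,
      ← Finset.sum_mul, hG.sum_gradComp_mul hx, hessGrad]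
  have h3 : ∑ b, ∑ l, (G x)⁻¹ b l * hess (conformal u G) f b l x
      = -laplacian G f x + 2 * dInner G u f x := by
    have e := hG.laplacian_conformal hu hx f
    simp only [laplacian, conformal_inv u (hG.det_ne_zero x hx), Matrix.smul_apply,
      smul_eq_mul, mul_assoc, ← Finset.mul_sum] at e ⊢
    refine mul_left_cancel₀ (Real.exp_ne_zero (-(2 * u x))) ?_
    linear_combination -e
  rw [h0, contract_sub (hG.sum_inv_mul hx), h1, h3]
  have h4 := h2 u h
  have h5 := h2 h u
  simp only [gradComp] at h4 h5
  rw [h4, h5, hG.hessGrad_comm hf hx h u, hG.hessGrad_comm hh hx f u, hG.dInner_comm hx h u,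
    hG.dInner_comm hx h f]
  ring

/-- The density has conformal weight `-4`: under `g ↦ e²ᵘ g` the terms in `du` of its four
summands cancel. -/
theorem coordA4_conformal (hf : ContDiffOn ℝ ∞ f U) (hh : ContDiffOn ℝ ∞ h U) (hx : x ∈ U) :
    coordA4 (conformal u G) f h x = Real.exp (-(2 * u x)) ^ 2 * coordA4 G f h x := by
  simp only [coordA4, hG.scalarCurv_conformal hu hx, hG.dInner_conformal hx,
    hG.laplacian_dInner_conformal hu hf hh hx, hG.hessInner_conformal hu hf hh hx,
    hG.laplacian_conformal hu hx, hG.dInner_dInner hf hh hx]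
  ring

end IsMetricOn

end Covariance

/-! ### Two metrics in a chart -/

section TwoMetrics

variable {M : Type*} [TopologicalSpace M] [ChartedSpace E4 M] [IsManifold (𝓡 4) ∞ M]
  {e : OpenPartialHomeomorph M E4} (he : e ∈ IsManifold.maximalAtlas (𝓡 4) ∞ M) (g h : Metric M)

/-- The pairs `(ε, y)` for which `g + ε h` is nondegenerate at the point with coordinates `y`. -/
def nondegenerateSet (e : OpenPartialHomeomorph M E4) (g h : BilinField M) : Set (ℝ × E4) :=
  {z | z.2 ∈ e.target ∧ (components e (perturb g h z.1) z.2).det ≠ 0}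

include he

theorem smoothFamilyOn_components_perturb (i j : Fin 4) :
    SmoothFamilyOn (Prod.snd ⁻¹' e.target)
      (fun ε y => components e (perturb g.inner h.inner ε) y i j) := by
  simp only [components_perturb, Matrix.add_apply, Matrix.smul_apply, smul_eq_mul]
  exact (smoothFamilyOn_const.2 (contDiffOn_components he g i j)).add
    (SmoothFamilyOn.mul (F := fun ε _ => ε) contDiff_fst.contDiffOn
      (smoothFamilyOn_const.2 (contDiffOn_components he h i j)))

theorem isOpen_nondegenerateSet : IsOpen (nondegenerateSet e g.inner h.inner) :=
  (smoothFamilyOn_det (smoothFamilyOn_components_perturb he g h)).continuousOn.isOpen_inter_preimage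
    (e.open_target.preimage continuous_snd) isOpen_ne

theorem zero_mem_nondegenerateSet {x : E4} (hx : x ∈ e.target) :
    ((0 : ℝ), x) ∈ nondegenerateSet e g.inner h.inner := by
  refine ⟨hx, ?_⟩
  simp only [components_perturb, zero_smul, add_zero]
  exact (det_components_pos he g hx).ne'

theorem eventually_mem_nondegenerateSet {x : E4} (hx : x ∈ e.target) :
    ∀ᶠ ε : ℝ in 𝓝 0, (ε, x) ∈ nondegenerateSet e g.inner h.inner :=
  (Continuous.prodMk_left x).continuousAt.eventually_mem
    ((isOpen_nondegenerateSet he g h).mem_nhds (zero_mem_nondegenerateSet he g h hx))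

theorem contDiffAt_connesA4 (f₁ f₂ : C^∞⟮𝓡 4, M; 𝓘(ℝ), ℝ⟯) {p : M} (hp : p ∈ e.source) :
    ContDiffAt ℝ ∞ (fun ε : ℝ => connesA4 e f₁ f₂ (perturb g.inner h.inner ε) p) 0 := by
  have hW : nondegenerateSet e g.inner h.inner ⊆ Prod.snd ⁻¹' e.target := fun z hz => hz.1
  have hs := fun f : C^∞⟮𝓡 4, M; 𝓘(ℝ), ℝ⟯ =>
    (smoothFamilyOn_const.2 (contDiffOn_comp_symm he f)).mono hW
  have hA := smoothFamilyOn_coordA4 (isOpen_nondegenerateSet he g h)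
    (fun i j => (smoothFamilyOn_components_perturb he g h i j).mono hW) (fun z hz => hz.2)
    (hs f₁) (hs f₂)
  exact hA.contDiffAt_param (isOpen_nondegenerateSet he g h)
    (zero_mem_nondegenerateSet he g h (e.map_source hp))

theorem isMetricOn_perturb (ε : ℝ) :
    IsMetricOn {y | (ε, y) ∈ nondegenerateSet e g.inner h.inner}
      (components e (perturb g.inner h.inner ε)) where
  isOpen := (isOpen_nondegenerateSet he g h).preimage (Continuous.prodMk_right ε)
  smooth i j := ((smoothFamilyOn_components_perturb he g h i j).mono fun _ hz => hz.1
    : SmoothFamilyOn (nondegenerateSet e g.inner h.inner) _).contDiffOn_slice ε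
  symm y _ i j := by
    simp only [components_perturb, Matrix.add_apply, Matrix.smul_apply,
      components_symm e _ y i j]
  det_ne_zero y hy := hy.2

variable {f : C^∞⟮𝓡 4, M; 𝓘(ℝ), ℝ⟯} (hf : ∀ p, 0 < f p)

include hf

theorem connesA4_scale (f₁ f₂ : C^∞⟮𝓡 4, M; 𝓘(ℝ), ℝ⟯) {p : M} (hp : p ∈ e.source) {ε : ℝ}
    (hε : (ε, e p) ∈ nondegenerateSet e g.inner h.inner) :
    connesA4 e f₁ f₂ (perturb (scale f g.inner) (scale f h.inner) ε) p
      = (f p)⁻¹ ^ 2 * connesA4 e f₁ f₂ (perturb g.inner h.inner ε) p := by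
  -- `f = e²ᵘ` for `u = ½ log f`
  have hexp : ∀ y, Real.exp (2 * (Real.log (f (e.symm y)) / 2)) = f (e.symm y) := by
    intro y
    rw [mul_div_cancel₀ _ two_ne_zero, Real.exp_log (hf _)]
  have hcomp : components e (perturb (scale f g.inner) (scale f h.inner) ε)
      = conformal (fun y => Real.log (f (e.symm y)) / 2)
        (components e (perturb g.inner h.inner ε)) := by
    ext1 y
    rw [conformal, hexp, ← components_scale]
    simp only [components_perturb, components_scale, smul_add, smul_comm ε]
  have hU : {y | (ε, y) ∈ nondegenerateSet e g.inner h.inner} ⊆ e.target := fun y hy => hy.1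
  have hs := fun f : C^∞⟮𝓡 4, M; 𝓘(ℝ), ℝ⟯ => (contDiffOn_comp_symm he f).mono hU
  have := (isMetricOn_perturb he g h ε).coordA4_conformal
    (((hs f).log fun y _ => (hf _).ne').div_const 2) (hs f₁) (hs f₂) hε
  rw [connesA4, hcomp, this, Real.exp_neg, hexp, e.left_inv hp, connesA4]

theorem connesA4Coeff_scale (f₁ f₂ : C^∞⟮𝓡 4, M; 𝓘(ℝ), ℝ⟯) {p : M} (hp : p ∈ e.source) (j : ℕ) :
    connesA4Coeff e f₁ f₂ j (scale f g.inner) (scale f h.inner) p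
      = (f p)⁻¹ ^ 2 * connesA4Coeff e f₁ f₂ j g.inner h.inner p := by
  rw [connesA4Coeff, connesA4Coeff, ← taylorCoeff_const_mul]
  refine taylorCoeff_congr ?_ j
  filter_upwards [eventually_mem_nondegenerateSet he g h (e.map_source hp)] with ε hε
  exact connesA4_scale he g h hf f₁ f₂ hp hε

theorem relMatrix_scale {p : M} (hp : p ∈ e.source) :
    relMatrix e (scale f g.inner) (scale f h.inner) p = relMatrix e g.inner h.inner p := by
  have hdet := (det_components_pos he g (e.map_source hp)).ne'
  have hinv : (f p • components e g.inner (e p))⁻¹ = (f p)⁻¹ • (components e g.inner (e p))⁻¹ := by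
    refine Matrix.inv_eq_left_inv ?_
    rw [Matrix.smul_mul, Matrix.mul_smul, smul_smul, inv_mul_cancel₀ (hf p).ne',
      Matrix.nonsing_inv_mul _ (isUnit_iff_ne_zero.2 hdet), one_smul]
  rw [relMatrix, components_scale, components_scale, e.left_inv hp, hinv, Matrix.smul_mul,
    Matrix.mul_smul, smul_smul, inv_mul_cancel₀ (hf p).ne', one_smul, relMatrix]

omit he hf in
theorem volForm_scale {p : M} (hp : p ∈ e.source) :
    volForm e (scale f g.inner) p = f p ^ 2 • volForm e g.inner p := by
  have h4 : f p ^ 4 = (f p ^ 2) ^ 2 := by ring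
  rw [volForm, volForm, components_scale, e.left_inv hp, Matrix.det_smul, Fintype.card_fin, h4,
    Real.sqrt_mul (sq_nonneg _), Real.sqrt_sq (sq_nonneg _), mul_smul]

/-- The weights of `A₄ʲ` and of the volume form are opposite, and `c_l` has weight zero. -/
theorem bimetricForm_scale (f₁ f₂ : C^∞⟮𝓡 4, M; 𝓘(ℝ), ℝ⟯) (j l : ℕ) :
    bimetricForm e f₁ f₂ j l (scale f g.inner) (scale f h.inner)
      = bimetricForm e f₁ f₂ j l g.inner h.inner := by
  ext1 p
  have hc : (f p)⁻¹ ^ 2 * connesA4Coeff e f₁ f₂ j g.inner h.inner p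
      * volCoeff e l g.inner h.inner p * f p ^ 2
      = connesA4Coeff e f₁ f₂ j g.inner h.inner p * volCoeff e l g.inner h.inner p := by
    have := (hf p).ne'
    field_simp
  rw [bimetricForm, bimetricForm, connesA4Coeff_scale he g h hf f₁ f₂ p.2,
    volForm_scale g p.2, volCoeff, relMatrix_scale he g h hf p.2, smul_smul]
  exact congrArg (· • _) hc

end TwoMetrics

end Bimetric

end

open Bimetric in
theorem mainTheorem3 {M : Type*} [TopologicalSpace M] [ChartedSpace E4 M]
    [IsManifold (𝓡 4) ∞ M] (o : OrientedAtlas M)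
    (f₁ f₂ : C^∞⟮𝓡 4, M; 𝓘(ℝ), ℝ⟯)
    (e : OpenPartialHomeomorph M E4) (he : e ∈ o.charts) :
    -- the coefficients are those of genuine expansions, and the `c_l` are given explicitly
    (∀ (g h : Metric M) (p : M), p ∈ e.source →
      (fun ε : ℝ => connesA4 e f₁ f₂ (perturb g.inner h.inner ε) p
        - (connesA4Coeff e f₁ f₂ 0 g.inner h.inner p
          + connesA4Coeff e f₁ f₂ 1 g.inner h.inner p * ε
          + connesA4Coeff e f₁ f₂ 2 g.inner h.inner p * ε ^ 2))
        =O[𝓝 0] (fun ε : ℝ => ε ^ 3) ∧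
      (fun ε : ℝ => Real.sqrt (1 + ε • relMatrix e g.inner h.inner p).det
        - (1 + volCoeff e 1 g.inner h.inner p * ε + volCoeff e 2 g.inner h.inner p * ε ^ 2))
        =O[𝓝 0] (fun ε : ℝ => ε ^ 3) ∧
      volCoeff e 0 g.inner h.inner p = 1 ∧
      volCoeff e 1 g.inner h.inner p = (∑ i, relMatrix e g.inner h.inner p i i) / 2 ∧
      volCoeff e 2 g.inner h.inner p =
        (1 / 2) * ((∑ i, ∑ k ∈ Finset.Ioi i,
            relMatrix e g.inner h.inner p i i * relMatrix e g.inner h.inner p k k)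
          - ∑ i, ∑ k ∈ Finset.Ioi i,
            relMatrix e g.inner h.inner p i k * relMatrix e g.inner h.inner p k i)
        - (1 / 8) * (∑ i, relMatrix e g.inner h.inner p i i) ^ 2) ∧
    -- the nine forms are bimetric conformal invariants
    (∀ j l : Fin 3, IsBimetricConformalInvariant (bimetricForm e f₁ f₂ j l)) := by
  have he' := o.mem_maximalAtlas e he
  refine ⟨fun g h p hp => ⟨?_, sqrt_det_one_add_smul_expansion _⟩, fun j l g h f hf =>
    bimetricForm_scale he' g h hf f₁ f₂ j l⟩
  exact sub_taylorCoeff_isBigO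
    ((contDiffAt_connesA4 he' g h f₁ f₂ hp).of_le (WithTop.coe_le_coe.2 le_top))
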